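/- Let $G$ be a torus of rank $r\ge 0$; subgroups of $G$ are closed and cohomology is rational, with $H^*(BT)=\mathrm{Sym}_{\mathbb Q}(\mathrm{Hom}(T,U(1))\otimes\mathbb Q)$ (characters in degree $2$) for a torus $T$. All rings and modules are $\mathbb Z$-graded, and maps of modules preserve degrees. For a connected subgroup $L$ let $\mathcal F/L$ be the set of subgroups of $G$ with identity component $L$ and let $\mathcal O_{\mathcal F/L}=\prod_{F\in\mathcal F/L}H^*(B(G/F))$ (product of graded rings). For a finite dimensional complex representation $V$ of $G/L$ let $c(V)\in\mathcal O_{\mathcal F/L}$ be the element whose component at $F$ is the Euler class of $V^F$, and for connected $K\supseteq L$ put $\mathcal E_{K/L}=\{c(V)\mid V \text{ a representation of } G/L,\ V^K=0\}$. The structure diagram is the diagram of rings $R(G/K)_{G/L}=\mathcal E_{K/L}^{-1}\mathcal O_{\mathcal F/L}$, indexed by the poset of pairs $L\subseteq K$ of connected subgroups of $G$. For connected $L\subseteq K\subseteq H$ it has horizontal maps $R(G/K)_{G/L}\to R(G/H)_{G/L}$ (localization) and vertical maps $R(G/H)_{G/K}\to R(G/H)_{G/L}$ (induced by the inflation $\mathcal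 O_{\mathcal F/K}\to\mathcal O_{\mathcal F/L}$, whose component at $F$ is the inflation $H^*(B(G/FK))\to H^*(B(G/F))$ applied to the component at $FK$). An $R$-module is a diagram $M$ of the same shape with $M(x)$ an $R(x)$-module and structure maps that are module maps over those of $R$. It is *quasi-coherent* if all its horizontal maps, and *extended* if all its vertical maps, are extensions of scalars, i.e. $R(y)\otimes_{R(x)}M(x)\to M(y)$ is an isomorphism. Let $\hat{\mathcal A}(G)$ be the full subcategory of extended $R$-modules, $\mathcal A(G)\subseteq\hat{\mathcal A}(G)$ the full subcategory of quasi-coherent extended $R$-modules, and $j$ the inclusion. **Theorem.** The inclusion $j:\mathcal A(G)\to\hat{\mathcal A}(G)$ has a right adjoint $\Gamma_h:\hat{\mathcal A}(G)\to\mathcal A(G)$ (the torsion functor). Its values are quasi-coherent; it fixes quasi-coherent objects, in that the unit $X\to\Gamma_h jX$ is an isomorphism for every $X$ in $\mathcal A(G)$ and the counit $j\Gamma_hY\to Y$ is an isomorphism for every quasi-coherent $Y$ in $\hat{\mathcal A}(G)$; and it is independent of choices: for any right adjoint $\Gamma'$ of $j$ there is a unique natural isomorphism $\Gamma_h\cong\Gamma'$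 compatible with the counits. -/

import Mathlib

open CategoryTheory TensorProduct

universe u

noncomputable section

namespace TorusModel

/-! ## Characters, cohomology of classifying spaces and Euler classes

`G` is a torus.  A subgroup of `G` always means a closed subgroup in the objects below. -/

section Cohomology

variable (G : Type u) [CommGroup G] [TopologicalSpace G]

/-- Continuous characters `G → U(1)`, a group under pointwise multiplication. -/
abbrev Character : Type u := G →ₜ* Circle

variable {G}

/-- The characters that are trivial on `H`, i.e. the character group of `G/H`. -/
def charsTrivialOn (H : Subgroup G) : Subgroup (Character G) where
  carrier := {χ | ∀ h ∈ H, χ h = 1}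
  one_mem' := fun _ _ => rfl
  mul_mem' := fun {a b} ha hb h hh => by
    have : (a * b) h = a h * b h := rfl
    rw [this, ha h hh, hb h hh, one_mul]
  inv_mem' := fun {a} ha h hh => by
    have : (a⁻¹) h = (a h)⁻¹ := rfl
    rw [this, ha h hh, inv_one]

theorem charsTrivialOn_anti {H H' : Subgroup G} (h : H ≤ H') :
    charsTrivialOn H' ≤ charsTrivialOn H := fun _ hχ x hx => hχ x (h hx)

theorem mem_charsTrivialOn_sup {H H' : Subgroup G} {χ : Character G} :
    χ ∈ charsTrivialOn (H ⊔ H') ↔ χ ∈ charsTrivialOn H ∧ χ ∈ charsTrivialOn H' := by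
  constructor
  · intro h
    exact ⟨charsTrivialOn_anti le_sup_left h, charsTrivialOn_anti le_sup_right h⟩
  · rintro ⟨h1, h2⟩ x hx
    obtain ⟨a, ha, b, hb, rfl⟩ := Subgroup.mem_sup.1 hx
    rw [map_mul, h1 a ha, h2 b hb, one_mul]

/-- `H²(B(G/H); ℚ)`, the rationalised character group of `G/H` (via first Chern classes). -/
abbrev RatChar (H : Subgroup G) : Type u := ℚ ⊗[ℤ] Additive (charsTrivialOn H)

/-- `H^*(B(G/H); ℚ)`: since `G/H` is a torus this is the symmetric algebra on
`H²(B(G/H); ℚ)`. -/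
def Coh (H : Subgroup G) : Type u := SymmetricAlgebra ℚ (RatChar H)

instance (H : Subgroup G) : CommRing (Coh H) :=
  inferInstanceAs (CommRing (SymmetricAlgebra ℚ (RatChar H)))

instance (H : Subgroup G) : Algebra ℚ (Coh H) :=
  inferInstanceAs (Algebra ℚ (SymmetricAlgebra ℚ (RatChar H)))

/-- The inclusion of `H²(B(G/H); ℚ)` in `H^*(B(G/H); ℚ)`. -/
def cohι (H : Subgroup G) : RatChar H →ₗ[ℚ] Coh H := SymmetricAlgebra.ι ℚ (RatChar H)

/-- The classes in `H²(B(G/H); ℚ)`. -/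
abbrev Coh2 (H : Subgroup G) : Submodule ℚ (Coh H) :=
  LinearMap.range (cohι H)

/-- `Hⁿ(B(G/H); ℚ)`: the `k`-fold products of degree two classes span degree `n = 2k`, and
there is nothing in odd or negative degrees. -/
def cohDeg (H : Subgroup G) (n : ℤ) : Submodule ℚ (Coh H) :=
  ⨆ (k : ℕ) (_ : 2 * (k : ℤ) = n), Coh2 H ^ k

/-- The classes of degree at most `2N`. -/
def cohLE (H : Subgroup G) (N : ℕ) : Submodule ℚ (Coh H) := (1 ⊔ Coh2 H) ^ N

theorem one_mem_sup (H : Subgroup G) : (1 : Coh H) ∈ 1 ⊔ Coh2 H :=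
  (le_sup_left : (1 : Submodule ℚ (Coh H)) ≤ 1 ⊔ Coh2 H) (Submodule.mem_one.2 ⟨1, map_one _⟩)

theorem cohLE_mono (H : Subgroup G) : Monotone (cohLE H) := by
  refine monotone_nat_of_le_succ fun N => ?_
  intro x hx
  have := Submodule.mul_mem_mul hx (one_mem_sup H)
  simpa [cohLE, pow_succ] using this

/-- The map `H²(B(G/H')) → H²(B(G/H))` induced by `G/H → G/H'`, for `H ≤ H'`. -/
def ratCharMap {H H' : Subgroup G} (h : H ≤ H') : RatChar H' →ₗ[ℚ] RatChar H :=
  LinearMap.baseChange ℚ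
    (MonoidHom.toAdditive (Subgroup.inclusion (charsTrivialOn_anti h))).toIntLinearMap

/-- Inflation `H^*(B(G/H')) → H^*(B(G/H))` along `G/H → G/H'`, for `H ≤ H'`. -/
def cohMap {H H' : Subgroup G} (h : H ≤ H') : Coh H' →ₐ[ℚ] Coh H :=
  SymmetricAlgebra.lift (A := Coh H) (cohι H ∘ₗ ratCharMap h)

theorem cohMap_ι {H H' : Subgroup G} (h : H ≤ H') (a : RatChar H') :
    cohMap h (cohι H' a) = cohι H (ratCharMap h a) :=
  SymmetricAlgebra.lift_ι_apply (A := Coh H) (f := cohι H ∘ₗ ratCharMap h) a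

theorem coh_algHom_ext {H : Subgroup G} {A : Type*} [CommRing A] [Algebra ℚ A]
    {f g : Coh H →ₐ[ℚ] A} (h : ∀ a, f (cohι H a) = g (cohι H a)) : f = g :=
  SymmetricAlgebra.algHom_ext (LinearMap.ext h)

theorem ratCharMap_refl {H : Subgroup G} (h : H ≤ H) (a : RatChar H) : ratCharMap h a = a := by
  have : (MonoidHom.toAdditive
      (Subgroup.inclusion (charsTrivialOn_anti h))).toIntLinearMap = LinearMap.id := rfl
  simp [ratCharMap, this]

theorem ratCharMap_trans {H H' H'' : Subgroup G} (h : H ≤ H') (h' : H' ≤ H'') (a : RatChar H'') :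
    ratCharMap h (ratCharMap h' a) = ratCharMap (h.trans h') a := by
  have : (MonoidHom.toAdditive
      (Subgroup.inclusion (charsTrivialOn_anti (h.trans h')))).toIntLinearMap =
      (MonoidHom.toAdditive (Subgroup.inclusion (charsTrivialOn_anti h))).toIntLinearMap ∘ₗ
      (MonoidHom.toAdditive (Subgroup.inclusion (charsTrivialOn_anti h'))).toIntLinearMap := rfl
  simp [ratCharMap, this, LinearMap.baseChange_comp]

theorem cohMap_refl {H : Subgroup G} (h : H ≤ H) (a : Coh H) : cohMap h a = a := by
  have : cohMap h = AlgHom.id ℚ (Coh H) := by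
    refine coh_algHom_ext fun x => ?_
    simp [cohMap_ι, ratCharMap_refl]
  rw [this, AlgHom.id_apply]

theorem cohMap_trans {H H' H'' : Subgroup G} (h : H ≤ H') (h' : H' ≤ H'') (a : Coh H'') :
    cohMap h (cohMap h' a) = cohMap (h.trans h') a := by
  have : (cohMap h).comp (cohMap h') = cohMap (h.trans h') := by
    refine coh_algHom_ext fun x => ?_
    simp [cohMap_ι, ratCharMap_trans]
  rw [← this, AlgHom.comp_apply]

theorem cohMap_mem_cohLE {H H' : Subgroup G} (h : H ≤ H') {N : ℕ} {a : Coh H'}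
    (ha : a ∈ cohLE H' N) : cohMap h a ∈ cohLE H N := by
  have key : Submodule.map (cohMap h).toLinearMap (1 ⊔ Coh2 H') ≤ 1 ⊔ Coh2 H := by
    rw [Submodule.map_sup, Submodule.map_one]
    refine sup_le_sup le_rfl ?_
    rintro _ ⟨_, ⟨x, rfl⟩, rfl⟩
    exact ⟨ratCharMap h x, (cohMap_ι h x).symm⟩
  have h2 : cohMap h a ∈ Submodule.map (cohMap h).toLinearMap ((1 ⊔ Coh2 H') ^ N) :=
    ⟨a, ha, rfl⟩
  rw [Submodule.map_pow] at h2
  exact pow_le_pow_left' key N h2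

open Classical in
/-- The Euler class of `χ^F` in `H^*(B(G/F); ℚ)`: the first Chern class of `χ` if `χ` is trivial
on `F`, and `1` otherwise (then `χ^F = 0`). -/
def charEuler (F : Subgroup G) (χ : Character G) : Coh F :=
  if h : χ ∈ charsTrivialOn F then
    cohι F ((1 : ℚ) ⊗ₜ[ℤ] Additive.ofMul ⟨χ, h⟩)
  else 1

theorem charEuler_mem (F : Subgroup G) (χ : Character G) : charEuler F χ ∈ cohLE F 1 := by
  unfold charEuler cohLE
  rw [pow_one]
  split_ifs with h
  · exact (le_sup_right : Coh2 F ≤ 1 ⊔ Coh2 F) ⟨_, rfl⟩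
  · exact one_mem_sup F

theorem cohMap_charEuler {H H' : Subgroup G} (h : H ≤ H') (χ : Character G)
    (hχ : χ ∈ charsTrivialOn H → χ ∈ charsTrivialOn H') :
    cohMap h (charEuler H' χ) = charEuler H χ := by
  unfold charEuler
  by_cases h1 : χ ∈ charsTrivialOn H
  · rw [dif_pos h1, dif_pos (hχ h1), cohMap_ι]
    rfl
  · rw [dif_neg h1, dif_neg (fun h2 => h1 (charsTrivialOn_anti h h2)), map_one]

/-- The classical Euler class of `V^F` in `H^*(B(G/F); ℚ)`.  A finite dimensional complex
representation `V` of the torus `G` is given by the multiset of its characters, and `V^F` is the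
sum of those characters of `V` that are trivial on `F`. -/
def repEuler (F : Subgroup G) (V : Multiset (Character G)) : Coh F :=
  (V.map (charEuler F)).prod

theorem repEuler_mem (F : Subgroup G) (V : Multiset (Character G)) :
    repEuler F V ∈ cohLE F V.card := by
  induction V using Multiset.induction_on with
  | empty => exact Submodule.mem_one.2 ⟨1, map_one _⟩
  | cons χ V ih =>
    have h := Submodule.mul_mem_mul ih (charEuler_mem F χ)
    rw [repEuler, Multiset.map_cons, Multiset.prod_cons, Multiset.card_cons, mul_comm, cohLE,
      pow_succ]
    rwa [cohLE, cohLE, pow_one] at h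

open Classical in
/-- `dim_ℂ V^F`. -/
def dimFixed (F : Subgroup G) (V : Multiset (Character G)) : ℕ :=
  V.countP (fun χ => χ ∈ charsTrivialOn F)

end Cohomology

/-! ## The ring `𝒪_{ℱ/L}` -/

section BasicRing

variable {G : Type u} [CommGroup G] [TopologicalSpace G]

/-- The family `ℱ/L` of finite subgroups of `G/L`, identified with their inverse images in `G`:
the subgroups of `G` that contain `L` with finite index (for `L` closed and connected, these are
the closed subgroups with identity component `L`). -/
abbrev FinSub (L : Subgroup G) : Type u := {F : Subgroup G // L ≤ F ∧ L.relIndex F ≠ 0}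

/-- The map `q : ℱ/L → ℱ/K`, `F ↦ FK`, for `L ≤ K`. -/
def FinSub.push {L K : Subgroup G} (h : L ≤ K) (F : FinSub L) : FinSub K :=
  ⟨F.1 ⊔ K, le_sup_right, by
    rw [Subgroup.relIndex_sup_right]
    intro h0
    have h1 := Subgroup.relIndex_dvd_of_le_left F.1 h
    rw [h0] at h1
    exact F.2.2 (Nat.eq_zero_of_zero_dvd h1)⟩

theorem FinSub.le_push {L K : Subgroup G} (h : L ≤ K) (F : FinSub L) : F.1 ≤ (F.push h).1 :=
  le_sup_left

/-- The families of classes in `H^*(B(G/F); ℚ)`, for `F ∈ ℱ/L`, whose degrees are bounded. -/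
def OSub (L : Subgroup G) : Subalgebra ℚ (∀ F : FinSub L, Coh F.1) where
  carrier := {f | ∃ N : ℕ, ∀ F, f F ∈ cohLE F.1 N}
  mul_mem' := by
    rintro a b ⟨N, hN⟩ ⟨M, hM⟩
    refine ⟨N + M, fun F => ?_⟩
    have := Submodule.mul_mem_mul (hN F) (hM F)
    simpa [cohLE, pow_add] using this
  add_mem' := by
    rintro a b ⟨N, hN⟩ ⟨M, hM⟩
    exact ⟨max N M, fun F => add_mem (cohLE_mono _ (le_max_left N M) (hN F))
      (cohLE_mono _ (le_max_right N M) (hM F))⟩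
  algebraMap_mem' := fun q => ⟨0, fun F => by
    rw [cohLE, pow_zero]
    exact Submodule.algebraMap_mem q⟩

/-- `𝒪_{ℱ/L} = ∏_F H^*(B(G/F); ℚ)`, the product over `F ∈ ℱ/L` being taken in graded rings:
it consists of the families of classes whose degrees are bounded. -/
def O (L : Subgroup G) : Type u := OSub L

instance (L : Subgroup G) : CommRing (O L) := inferInstanceAs (CommRing (OSub L))

/-- The component of an element of `𝒪_{ℱ/L}` at `F`. -/
def O.comp {L : Subgroup G} (F : FinSub L) : O L →+* Coh F.1 :=
  (Pi.evalRingHom (fun F : FinSub L => Coh F.1) F).comp (OSub L).val.toRingHom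

/-- An element of `𝒪_{ℱ/L}` from its components. -/
def O.mk {L : Subgroup G} (f : ∀ F : FinSub L, Coh F.1) (hf : ∃ N, ∀ F, f F ∈ cohLE F.1 N) :
    O L := ⟨f, hf⟩

theorem O.comp_mk {L : Subgroup G} (f : ∀ F : FinSub L, Coh F.1) (hf) (F : FinSub L) :
    O.comp F (O.mk f hf) = f F := rfl

theorem O.bounded {L : Subgroup G} (f : O L) : ∃ N, ∀ F, O.comp F f ∈ cohLE F.1 N := f.2

theorem O.ext {L : Subgroup G} {f g : O L} (h : ∀ F, O.comp F f = O.comp F g) : f = g :=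
  Subtype.ext (funext h)

/-- The component at `F` of the inflation map `𝒪_{ℱ/K} → 𝒪_{ℱ/L}` for `L ≤ K`: the inflation
`H^*(B(G/FK)) → H^*(B(G/F))` along `G/F → G/FK`, applied to the component at `FK`. -/
def inflComp {L K : Subgroup G} (h : L ≤ K) (F : FinSub L) : O K →+* Coh F.1 :=
  (cohMap (F.le_push h)).toRingHom.comp (O.comp (F.push h))

theorem inflComp_apply {L K : Subgroup G} (h : L ≤ K) (F : FinSub L) (f : O K) :
    inflComp h F f = cohMap (F.le_push h) (O.comp (F.push h) f) := rfl

/-- The inflation map `𝒪_{ℱ/K} → 𝒪_{ℱ/L}` for `L ≤ K`. -/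
def infl {L K : Subgroup G} (h : L ≤ K) : O K →+* O L where
  toFun f := O.mk (fun F => inflComp h F f) (by
    obtain ⟨N, hN⟩ := f.bounded
    exact ⟨N, fun F => cohMap_mem_cohLE _ (hN _)⟩)
  map_one' := O.ext fun F => map_one (inflComp h F)
  map_mul' a b := O.ext fun F => map_mul (inflComp h F) a b
  map_zero' := O.ext fun F => map_zero (inflComp h F)
  map_add' a b := O.ext fun F => map_add (inflComp h F) a b

theorem infl_apply {L K : Subgroup G} (h : L ≤ K) (f : O K) (F : FinSub L) :
    O.comp F (infl h f) = cohMap (F.le_push h) (O.comp (F.push h) f) := rfl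

theorem cohMap_congr {L : Subgroup G} (f : O L) {A : Subgroup G}
    {F F' : FinSub L} (e : F = F') (h : A ≤ F.1) (h' : A ≤ F'.1) :
    cohMap h (O.comp F f) = cohMap h' (O.comp F' f) := by
  subst e; rfl

theorem infl_refl {L : Subgroup G} (h : L ≤ L) (f : O L) : infl h f = f := by
  refine O.ext fun F => ?_
  have e : F.push h = F := Subtype.ext (sup_eq_left.2 F.2.1)
  rw [infl_apply, cohMap_congr f e _ le_rfl, cohMap_refl]

theorem infl_trans {L K H : Subgroup G} (h : L ≤ K) (h' : K ≤ H) (f : O H) :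
    infl h (infl h' f) = infl (h.trans h') f := by
  refine O.ext fun F => ?_
  have e : (F.push h).push h' = F.push (h.trans h') := by
    refine Subtype.ext ?_
    change F.1 ⊔ K ⊔ H = F.1 ⊔ H
    rw [sup_assoc, sup_eq_right.2 h']
  rw [infl_apply, infl_apply, infl_apply, cohMap_trans]
  exact cohMap_congr f e _ _

/-- The Euler class `c(V) ∈ 𝒪_{ℱ/L}`, with components `c(V)(F) = c_H(V^F)`. -/
def euler (L : Subgroup G) (V : Multiset (Character G)) : O L :=
  O.mk (fun F => repEuler F.1 V) ⟨V.card, fun F => repEuler_mem F.1 V⟩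

theorem comp_euler {L : Subgroup G} (V : Multiset (Character G)) (F : FinSub L) :
    O.comp F (euler L V) = repEuler F.1 V := rfl

theorem euler_zero (L : Subgroup G) : euler L 0 = 1 := O.ext fun F => by
  rw [comp_euler, map_one, repEuler, Multiset.map_zero, Multiset.prod_zero]

theorem euler_add (L : Subgroup G) (V W : Multiset (Character G)) :
    euler L (V + W) = euler L V * euler L W := O.ext fun F => by
  rw [map_mul, comp_euler, comp_euler, comp_euler, repEuler, Multiset.map_add,
    Multiset.prod_add, repEuler, repEuler]

/-- `V` is a representation of `G/L`. -/
def IsRepOfQuotient (L : Subgroup G) (V : Multiset (Character G)) : Prop :=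
  ∀ χ ∈ V, χ ∈ charsTrivialOn L

/-- `V^K = 0`. -/
def FixedZero (K : Subgroup G) (V : Multiset (Character G)) : Prop :=
  ∀ χ ∈ V, χ ∉ charsTrivialOn K

/-- The multiplicative set `ℰ_{K/L} ⊆ 𝒪_{ℱ/L}` of Euler classes `c(V)` of representations `V`
of `G/L` with `V^K = 0`. -/
def eulerSet (L K : Subgroup G) : Submonoid (O L) where
  carrier := {c | ∃ V : Multiset (Character G),
    IsRepOfQuotient L V ∧ FixedZero K V ∧ c = euler L V}
  one_mem' := ⟨0, by simp [IsRepOfQuotient], by simp [FixedZero],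
    (euler_zero L).symm⟩
  mul_mem' := by
    rintro _ _ ⟨V, hV, hV', rfl⟩ ⟨W, hW, hW', rfl⟩
    refine ⟨V + W, ?_, ?_, (euler_add L V W).symm⟩
    · intro χ hχ
      exact (Multiset.mem_add.1 hχ).elim (hV χ) (hW χ)
    · intro χ hχ
      exact (Multiset.mem_add.1 hχ).elim (hV' χ) (hW' χ)

theorem infl_euler {L K : Subgroup G} (h : L ≤ K) {V : Multiset (Character G)}
    (hV : IsRepOfQuotient K V) : infl h (euler K V) = euler L V := by
  refine O.ext fun F => ?_
  rw [infl_apply, comp_euler, comp_euler]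
  rw [repEuler, map_multiset_prod, Multiset.map_map, repEuler]
  congr 1
  refine Multiset.map_congr rfl fun χ hχ => ?_
  exact cohMap_charEuler _ χ fun h1 => mem_charsTrivialOn_sup.2 ⟨h1, hV χ hχ⟩

theorem euler_mem_eulerSet {L K : Subgroup G} {V : Multiset (Character G)}
    (hV : IsRepOfQuotient L V) (hV' : FixedZero K V) : euler L V ∈ eulerSet L K :=
  ⟨V, hV, hV', rfl⟩

theorem infl_mem_eulerSet {L K H H' : Subgroup G} (h : L ≤ K) (h' : H ≤ H') {c : O K}
    (hc : c ∈ eulerSet K H) : infl h c ∈ eulerSet L H' := by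
  obtain ⟨V, hV, hV', rfl⟩ := hc
  exact ⟨V, fun χ hχ => charsTrivialOn_anti h (hV χ hχ),
    fun χ hχ h1 => hV' χ hχ (charsTrivialOn_anti h' h1), infl_euler h hV⟩

end BasicRing

/-! ## The diagram of quotient pairs and the structure diagram of rings -/

section Diagram

variable (G : Type u) [CommGroup G] [TopologicalSpace G]

/-- The poset of (closed) connected subgroups of `G`. -/
abbrev ConnSub : Type u := {H : Subgroup G // IsClosed (H : Set G) ∧ IsConnected (H : Set G)}

/-- The poset of quotient pairs: the object `(G/K)_{G/L}` is given by connected subgroups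
`L ≤ K`. -/
@[ext]
structure QuotPair where
  /-- the upper subgroup, indexing the column of `G/K` -/
  K : ConnSub G
  /-- the lower subgroup, indexing the row of `G/L` -/
  L : ConnSub G
  le : L ≤ K

variable {G}

/-- There is a morphism `(G/K)_{G/L} → (G/H)_{G/M}` when `M ≤ L ≤ K ≤ H`: horizontal morphisms
enlarge the upper subgroup, and vertical ones shrink the lower subgroup. -/
instance : PartialOrder (QuotPair G) where
  le x y := x.K ≤ y.K ∧ y.L ≤ x.L
  le_refl _ := ⟨le_rfl, le_rfl⟩
  le_trans _ _ _ h h' := ⟨h.1.trans h'.1, h'.2.trans h.2⟩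
  le_antisymm _ _ h h' := QuotPair.ext (le_antisymm h.1 h'.1) (le_antisymm h'.2 h.2)

/-- The horizontal morphism `(G/K)_{G/L} → (G/H)_{G/L}` for `L ≤ K ≤ H`. -/
theorem horizontal_le {L K H : ConnSub G} (h : L ≤ K) (h' : K ≤ H) :
    (⟨K, L, h⟩ : QuotPair G) ≤ ⟨H, L, h.trans h'⟩ := ⟨h', le_rfl⟩

/-- The vertical morphism `(G/H)_{G/K} → (G/H)_{G/L}` for `L ≤ K ≤ H`. -/
theorem vertical_le {L K H : ConnSub G} (h : L ≤ K) (h' : K ≤ H) :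
    (⟨H, K, h'⟩ : QuotPair G) ≤ ⟨H, L, h.trans h'⟩ := ⟨le_rfl, h⟩

/-- The structure diagram `R(G/K)_{G/L} = ℰ_{K/L}⁻¹ 𝒪_{ℱ/L}`. -/
def R (x : QuotPair G) : Type u := Localization (eulerSet x.L.1 x.K.1)

instance (x : QuotPair G) : CommRing (R x) :=
  inferInstanceAs (CommRing (Localization (eulerSet x.L.1 x.K.1)))

instance (x : QuotPair G) : Algebra (O x.L.1) (R x) :=
  inferInstanceAs (Algebra (O x.L.1) (Localization (eulerSet x.L.1 x.K.1)))

instance (x : QuotPair G) : IsLocalization (eulerSet x.L.1 x.K.1) (R x) :=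
  inferInstanceAs (IsLocalization _ (Localization (eulerSet x.L.1 x.K.1)))

/-- The structure maps of `R`: they are induced by inflation, so the horizontal ones are
localizations. -/
def ringMap {x y : QuotPair G} (h : x ≤ y) : R x →+* R y :=
  IsLocalization.map (M := eulerSet x.L.1 x.K.1) (T := eulerSet y.L.1 y.K.1) (R y) (infl h.2)
    (fun _ hc => infl_mem_eulerSet h.2 h.1 hc)

theorem ringMap_algebraMap {x y : QuotPair G} (h : x ≤ y) (f : O x.L.1) :
    ringMap h (algebraMap _ (R x) f) = algebraMap _ (R y) (infl h.2 f) :=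
  IsLocalization.map_eq (M := eulerSet x.L.1 x.K.1) (S := R x) (Q := R y) _ f

theorem ringMap_refl (x : QuotPair G) (h : x ≤ x) (a : R x) : ringMap h a = a := by
  have : ringMap h = RingHom.id (R x) := by
    refine IsLocalization.ringHom_ext (eulerSet x.L.1 x.K.1) (RingHom.ext fun f => ?_)
    simp [ringMap_algebraMap, infl_refl]
  rw [this, RingHom.id_apply]

theorem ringMap_trans {x y z : QuotPair G} (h : x ≤ y) (h' : y ≤ z) (a : R x) :
    ringMap h' (ringMap h a) = ringMap (h.trans h') a := by
  have : (ringMap h').comp (ringMap h) = ringMap (h.trans h') := by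
    refine IsLocalization.ringHom_ext (eulerSet x.L.1 x.K.1) (RingHom.ext fun f => ?_)
    simp [ringMap_algebraMap, infl_trans]
  rw [← this, RingHom.comp_apply]

/-- The homogeneous elements of (cohomological) degree `n` in the graded ring
`R(G/K)_{G/L} = ℰ_{K/L}⁻¹ 𝒪_{ℱ/L}`: the fractions `a / c(V)` such that the component of `a` at
every `F` has degree `n + 2 dim V^F`, the degree of the component `c(V)(F)` being
`2 dim V^F`. -/
def ringDeg (x : QuotPair G) (n : ℤ) : Set (R x) :=
  {s | ∃ (V : Multiset (Character G)) (hV : IsRepOfQuotient x.L.1 V) (hV' : FixedZero x.K.1 V)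
    (a : O x.L.1),
    (∀ F : FinSub x.L.1, O.comp F a ∈ cohDeg F.1 (n + 2 * (dimFixed F.1 V : ℤ))) ∧
      s = IsLocalization.mk' (R x) a
        (⟨euler x.L.1 V, euler_mem_eulerSet hV hV'⟩ : eulerSet x.L.1 x.K.1)}

end Diagram

/-! ## Modules over the structure diagram -/

/-- A map `f : M → N` that is semilinear over a ring map `σ : A → B` is an extension of scalars if
the induced map `B ⊗_A M → N` of `B`-modules is an isomorphism. -/
def IsExtensionOfScalars {A B : Type u} [CommRing A] [CommRing B] (σ : A →+* B)
    {M N : Type u} [AddCommGroup M] [AddCommGroup N] [Module A M] [Module B N]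
    (f : M →ₛₗ[σ] N) : Prop :=
  letI : Algebra A B := σ.toAlgebra
  letI : Module A N := Module.compHom N σ
  haveI : IsScalarTower A B N := ⟨fun a b n => mul_smul (σ a) b n⟩
  IsBaseChange B ({ toFun := f, map_add' := map_add f, map_smul' := map_smulₛₗ f } : M →ₗ[A] N)

section Modules

variable (G : Type u) [CommGroup G] [TopologicalSpace G]

/-- A (graded) `R`-module: a diagram `M` of graded abelian groups indexed by quotient pairs, such
that each `M x` is a graded module over the graded ring `R x`, and the structure maps
`M x → M y` preserve degrees and are module maps over `R x → R y`. -/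
structure RMod where
  /-- the underlying module at each quotient pair -/
  obj : QuotPair G → Type u
  [addCommGroup : ∀ x, AddCommGroup (obj x)]
  [module : ∀ x, Module (R x) (obj x)]
  /-- the homogeneous parts -/
  deg : ∀ x, ℤ → AddSubgroup (obj x)
  isInternal : ∀ x, DirectSum.IsInternal (deg x)
  smul_mem : ∀ (x : QuotPair G) (i j : ℤ) (s : R x) (m : obj x),
    s ∈ ringDeg x i → m ∈ deg x j → s • m ∈ deg x (i + j)
  /-- the structure maps -/
  map : ∀ {x y : QuotPair G} (h : x ≤ y), obj x →ₛₗ[ringMap h] obj y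
  map_mem : ∀ {x y : QuotPair G} (h : x ≤ y) (n : ℤ) (m : obj x),
    m ∈ deg x n → map h m ∈ deg y n
  map_refl : ∀ (x : QuotPair G) (m : obj x), map (le_refl x) m = m
  map_trans : ∀ {x y z : QuotPair G} (h : x ≤ y) (h' : y ≤ z) (m : obj x),
    map h' (map h m) = map (h.trans h') m

attribute [instance] RMod.addCommGroup RMod.module

variable {G}

/-- A map of `R`-modules: a natural family of degree preserving module maps. -/
@[ext]
structure RMod.Hom (M N : RMod G) where
  /-- the component at each quotient pair -/
  app : ∀ x, M.obj x →ₗ[R x] N.obj x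
  app_mem : ∀ (x : QuotPair G) (n : ℤ) (m : M.obj x), m ∈ M.deg x n → app x m ∈ N.deg x n
  naturality : ∀ {x y : QuotPair G} (h : x ≤ y) (m : M.obj x),
    app y (M.map h m) = N.map h (app x m)

instance : Category (RMod G) where
  Hom M N := RMod.Hom M N
  id M := ⟨fun _ => LinearMap.id, fun _ _ _ h => h, fun _ _ => rfl⟩
  comp f g := ⟨fun x => (g.app x).comp (f.app x),
    fun x n m h => g.app_mem x n _ (f.app_mem x n m h),
    fun h m => by simp [f.naturality, g.naturality]⟩

variable (G)

/-- `M` is extended if its vertical structure maps `M(G/H)_{G/K} → M(G/H)_{G/L}`, for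
`L ≤ K ≤ H`, are extensions of scalars. -/
def IsExtended : ObjectProperty (RMod G) := fun M =>
  ∀ (L K H : ConnSub G) (h : L ≤ K) (h' : K ≤ H),
    IsExtensionOfScalars (ringMap (vertical_le h h')) (M.map (vertical_le h h'))

/-- `M` is quasi-coherent if its horizontal structure maps `M(G/K)_{G/L} → M(G/H)_{G/L}`, for
`L ≤ K ≤ H`, are extensions of scalars. -/
def IsQuasiCoherent : ObjectProperty (RMod G) := fun M =>
  ∀ (L K H : ConnSub G) (h : L ≤ K) (h' : K ≤ H),
    IsExtensionOfScalars (ringMap (horizontal_le h h')) (M.map (horizontal_le h h'))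

/-- The category `Â(G)` of extended `R`-modules. -/
abbrev AHat : Type (u + 1) := (IsExtended G).FullSubcategory

/-- The category `A(G)` of quasi-coherent extended `R`-modules. -/
abbrev ACat : Type (u + 1) := (IsQuasiCoherent G ⊓ IsExtended G).FullSubcategory

/-- The inclusion `j : A(G) → Â(G)`. -/
abbrev incl : ACat G ⥤ AHat G := ObjectProperty.ιOfLE inf_le_right

end Modules

end TorusModel

end

/-! An `R`-module lies in `ACat G` when it turns every horizontal and every vertical arrow into an
extension of scalars; call it coherent here. Extension of scalars commutes with colimits, so
coherent modules are closed under colimits of `R`-modules (`isExtensionOfScalars_colim`). The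
torsion of `N` should thus be the colimit of all coherent modules over `N`; the only obstacle is
size.

The obstacle is removed by a Löwenheim–Skolem argument (`exists_small_sub`): any small set of
elements of a coherent module lies in a small coherent graded subdiagram `P`. Flatness is not used,
so tensoring the inclusion of `P` may fail to be injective, and two conditions have to be forced
along each arrow `x ≤ y`: elements of `P` at `y` are combinations of images from `P` at `x`, and
every relation between such images follows from the tensor relations among elements of `P` itself.
Each instance needs only finitely many further elements, so countably many rounds of closing up
suffice.

Hence `torsion` is the colimit of the small coherent modules over `N`, one for each code. A coherent
`X` over `N` is the directed union of its small coherent subdiagrams; their canonical maps to the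
colimit agree and glue to `torsionLift`. Uniqueness (`eq_lift`) holds because lifting is natural
over `N` and the lift of the counit is the identity. The remaining claims are formal: `incl` is
fully faithful, and right adjoints are unique. -/

noncomputable section

namespace TorusModel

/-! ### Extension of scalars by universal property and by generators and relations -/

section ExtensionOfScalars

variable {A B : Type u} [CommRing A] [CommRing B] {σ : A →+* B}
  {M N : Type u} [AddCommGroup M] [AddCommGroup N] [Module A M] [Module B N]

/-- The universal property of an extension of scalars, without tensor products. -/
theorem isExtensionOfScalars_iff_existsUnique (f : M →ₛₗ[σ] N) :
    IsExtensionOfScalars σ f ↔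
      ∀ (Z : Type u) [AddCommGroup Z] [Module B Z] (g : M →ₛₗ[σ] Z),
        ∃! g' : N →ₗ[B] Z, ∀ m, g' (f m) = g m := by
  let : Algebra A B := σ.toAlgebra
  let : Module A N := Module.compHom N σ
  have : IsScalarTower A B N := ⟨fun a b n => mul_smul (σ a) b n⟩
  unfold IsExtensionOfScalars
  constructor
  · intro h Z _ _ g
    let : Module A Z := Module.compHom Z σ
    have : IsScalarTower A B Z := ⟨fun a b n => mul_smul (σ a) b n⟩
    let g₀ : M →ₗ[A] Z := { toFun := g, map_add' := map_add g, map_smul' := map_smulₛₗ g }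
    obtain ⟨g', h1, h2⟩ := IsBaseChange.iff_lift_unique.1 h Z g₀
    refine ⟨g', fun m => LinearMap.congr_fun h1 m, fun k hk => h2 k ?_⟩
    ext m
    exact hk m
  · intro h
    refine IsBaseChange.iff_lift_unique.2 ?_
    intro Z _ _ _ _ g
    -- `IsBaseChange.iff_lift_unique` tests against additive monoids; over the ring `B` these have
    -- negatives, given by the scalar `-1`.
    let : AddCommGroup Z := Module.addCommMonoidToAddCommGroup B
    let g₀ : M →ₛₗ[σ] Z :=
      { toFun := g, map_add' := map_add g, map_smul' := fun a m => by
          rw [map_smul]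
          exact (algebraMap_smul B a (g m)).symm }
    obtain ⟨g', h1, h2⟩ := h Z g₀
    refine ⟨g', LinearMap.ext fun m => h1 m, fun k hk => h2 k fun m => LinearMap.congr_fun hk m⟩

variable (σ) in
/-- The relations among formal `B`-linear combinations of elements of `M` that hold in `B ⊗_A M`
because of additivity and `A`-linearity on elements of `W`. -/
def tensorRel (W : Set M) : Submodule B (M →₀ B) :=
  Submodule.span B
    ({w | ∃ m ∈ W, ∃ m' ∈ W,
        w = Finsupp.single (m + m') 1 - Finsupp.single m 1 - Finsupp.single m' 1} ∪
      {w | ∃ a : A, ∃ m ∈ W, w = Finsupp.single (a • m) 1 - Finsupp.single m (σ a)})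

theorem tensorRel_mono {W W' : Set M} (h : W ⊆ W') : tensorRel σ W ≤ tensorRel σ W' := by
  refine Submodule.span_mono (Set.union_subset_union ?_ ?_)
  · rintro w ⟨m, hm, m', hm', rfl⟩
    exact ⟨m, h hm, m', h hm', rfl⟩
  · rintro w ⟨a, m, hm, rfl⟩
    exact ⟨a, m, h hm, rfl⟩

/-- A derivation of a relation uses finitely many generators, each mentioning finitely many
elements. This finiteness is what allows relations to be witnessed inside a small subdiagram. -/
theorem exists_finset_mem_tensorRel {w : M →₀ B} (hw : w ∈ tensorRel σ (Set.univ : Set M)) :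
    ∃ W : Finset M, w ∈ tensorRel σ (W : Set M) := by
  classical
  refine Submodule.span_induction (p := fun w _ => ∃ W : Finset M, w ∈ tensorRel σ (W : Set M))
    ?_ ⟨∅, zero_mem _⟩ ?_ ?_ hw
  · rintro w (⟨m, -, m', -, rfl⟩ | ⟨a, m, -, rfl⟩)
    · exact ⟨{m, m'}, Submodule.subset_span (Or.inl ⟨m, by simp, m', by simp, rfl⟩)⟩
    · exact ⟨{m}, Submodule.subset_span (Or.inr ⟨a, m, by simp, rfl⟩)⟩
  · rintro x y - - ⟨W, hW⟩ ⟨W', hW'⟩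
    exact ⟨W ∪ W', add_mem (tensorRel_mono (by simp) hW) (tensorRel_mono (by simp) hW')⟩
  · rintro b x - ⟨W, hW⟩
    exact ⟨W, Submodule.smul_mem _ b hW⟩

-- Extending `g` by zero outside `P` is harmless: `P` is closed under sums and multiples, so the
-- generating relations over `P` only see the true values of `g`.
open Classical in
theorem linearCombination_eq_zero_of_mem_tensorRel {Z : Type*} [AddCommGroup Z] [Module B Z]
    (P : Submodule A M) (g : P →ₛₗ[σ] Z) {w : M →₀ B} (hw : w ∈ tensorRel σ (P : Set M)) :
    Finsupp.linearCombination B (fun m => if h : m ∈ P then g ⟨m, h⟩ else 0) w = 0 := by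
  refine (Submodule.span_le (p := LinearMap.ker (Finsupp.linearCombination B
    (fun m => if h : m ∈ P then g ⟨m, h⟩ else 0)))).2 ?_ hw
  rintro w (⟨m, hm, m', hm', rfl⟩ | ⟨a, m, hm, rfl⟩)
  · have hm : m ∈ P := hm
    have hm' : m' ∈ P := hm'
    have e : g ⟨m + m', add_mem hm hm'⟩ = g ⟨m, hm⟩ + g ⟨m', hm'⟩ := by
      rw [← map_add]; rfl
    simp [hm, hm', add_mem hm hm', e]
  · have hm : m ∈ P := hm
    have e : g ⟨a • m, P.smul_mem a hm⟩ = σ a • g ⟨m, hm⟩ := by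
      rw [← map_smulₛₗ]; rfl
    simp [hm, P.smul_mem a hm, e]

/-- The zero map and the projection to the quotient by the span both extend the zero map on `M`,
hence coincide. -/
theorem IsExtensionOfScalars.span_range_eq_top {f : M →ₛₗ[σ] N}
    (hf : IsExtensionOfScalars σ f) : Submodule.span B (Set.range f) = ⊤ := by
  rw [isExtensionOfScalars_iff_existsUnique] at hf
  obtain ⟨k, -, hk⟩ := hf (N ⧸ Submodule.span B (Set.range f)) 0
  have h1 := hk 0 fun m => rfl
  have h2 := hk (Submodule.mkQ _) fun m =>
    (Submodule.Quotient.mk_eq_zero _).2 (Submodule.subset_span ⟨m, rfl⟩)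
  rw [← Submodule.ker_mkQ (Submodule.span B (Set.range f)), h2.trans h1.symm, LinearMap.ker_zero]

/-- Formal combinations modulo `tensorRel` receive a semilinear map from `M`. By the universal
property of `N` the quotient map factors through evaluation in `N`, so whatever evaluates to zero is
a tensor relation. -/
theorem IsExtensionOfScalars.mem_tensorRel {f : M →ₛₗ[σ] N}
    (hf : IsExtensionOfScalars σ f) {w : M →₀ B} (hw : Finsupp.linearCombination B f w = 0) :
    w ∈ tensorRel σ (Set.univ : Set M) := by
  rw [isExtensionOfScalars_iff_existsUnique] at hf
  let q := (tensorRel σ (Set.univ : Set M)).mkQ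
  have hq : ∀ {a b : M →₀ B}, a - b ∈ tensorRel σ (Set.univ : Set M) → q a = q b := fun h =>
    (Submodule.Quotient.eq _).2 h
  let g : M →ₛₗ[σ] ((M →₀ B) ⧸ tensorRel σ (Set.univ : Set M)) :=
    { toFun := fun m => q (Finsupp.single m 1)
      map_add' := fun m m' => by
        rw [← map_add]
        refine hq ?_
        rw [← sub_sub]
        exact Submodule.subset_span (Or.inl ⟨m, trivial, m', trivial, rfl⟩)
      map_smul' := fun a m => by
        rw [← map_smul]
        refine hq ?_
        rw [Finsupp.smul_single, smul_eq_mul, mul_one]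
        exact Submodule.subset_span (Or.inr ⟨a, m, trivial, rfl⟩) }
  obtain ⟨k, hk, -⟩ := hf _ g
  have : k ∘ₗ Finsupp.linearCombination B f = q := by
    refine Finsupp.lhom_ext' fun m => LinearMap.ext_ring ?_
    simp only [LinearMap.comp_apply, Finsupp.lsingle_apply, Finsupp.linearCombination_single,
      one_smul]
    exact hk m
  have h0 : q w = 0 := by rw [← this, LinearMap.comp_apply, hw, map_zero]
  exact (Submodule.Quotient.mk_eq_zero _).1 h0

/-- A criterion for a map of submodules to be an extension of scalars. -/
theorem isExtensionOfScalars_of_submodule (f : M →ₛₗ[σ] N) (P : Submodule A M)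
    (P' : Submodule B N) (f' : P →ₛₗ[σ] P') (hf' : ∀ m, (f' m : N) = f m)
    (hspan : ∀ n ∈ P', n ∈ Submodule.span B (f '' P))
    (hrel : ∀ w : M →₀ B, (w.support : Set M) ⊆ P → Finsupp.linearCombination B f w = 0 →
      w ∈ tensorRel σ (P : Set M)) :
    IsExtensionOfScalars σ f' := by
  classical
  rw [isExtensionOfScalars_iff_existsUnique]
  intro Z _ _ g
  have hspan' : Submodule.span B (Set.range f') = ⊤ := by
    refine eq_top_iff.2 fun n _ => ?_
    have h1 := hspan n n.2
    have h2 : f '' P = P'.subtype '' Set.range f' := by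
      ext y
      constructor
      · rintro ⟨m, hm, rfl⟩
        exact ⟨f' ⟨m, hm⟩, ⟨_, rfl⟩, hf' _⟩
      · rintro ⟨_, ⟨m, rfl⟩, rfl⟩
        exact ⟨m, m.2, (hf' m).symm⟩
    rw [h2, Submodule.span_image] at h1
    obtain ⟨n', hn', e⟩ := h1
    rwa [← Subtype.ext e]
  let Φ : (P →₀ B) →ₗ[B] P' := Finsupp.linearCombination B f'
  let Ψ : (P →₀ B) →ₗ[B] Z := Finsupp.linearCombination B g
  have hΦ : Function.Surjective Φ := by
    rw [← LinearMap.range_eq_top, Finsupp.range_linearCombination, hspan']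
  -- A relation that holds in `P'` is pushed to `M`, where `hrel` derives it inside `P`; therefore
  -- `g` respects it, and `Ψ` descends along the surjection `Φ`.
  have hker : LinearMap.ker Φ ≤ LinearMap.ker Ψ := by
    intro w hw
    have h1 := linearCombination_eq_zero_of_mem_tensorRel P g
      (hrel (w.mapDomain Subtype.val) ?_ ?_)
    · rw [Finsupp.linearCombination_mapDomain] at h1
      rw [LinearMap.mem_ker, ← h1]
      refine congrArg (fun k => Finsupp.linearCombination B k w) (funext fun m => ?_)
      simp
    · intro m hm
      obtain ⟨p, -, rfl⟩ := Finset.mem_image.1 (Finsupp.mapDomain_support hm)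
      exact p.2
    · rw [Finsupp.linearCombination_mapDomain]
      have h2 : (f : M → N) ∘ Subtype.val = P'.subtype ∘ f' := funext fun m => (hf' m).symm
      rw [h2, ← LinearMap.map_finsupp_linearCombination]
      rw [LinearMap.mem_ker] at hw
      exact (congrArg P'.subtype hw).trans (map_zero _)
  have hcomp : ∀ w, ((LinearMap.ker Φ).liftQ Ψ hker ∘ₗ
      (Φ.quotKerEquivOfSurjective hΦ).symm.toLinearMap) (Φ w) = Ψ w := by
    intro w
    have : (Φ.quotKerEquivOfSurjective hΦ).symm (Φ w) = Submodule.Quotient.mk w := by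
      rw [LinearEquiv.symm_apply_eq]
      rfl
    rw [LinearMap.comp_apply, LinearEquiv.coe_coe, this, Submodule.liftQ_apply]
  refine ⟨(LinearMap.ker Φ).liftQ Ψ hker ∘ₗ
    (Φ.quotKerEquivOfSurjective hΦ).symm.toLinearMap, fun m => ?_, fun k hk => ?_⟩
  · have := hcomp (Finsupp.single m 1)
    simpa [Φ, Ψ] using this
  · refine LinearMap.ext_on_range hspan' fun m => ?_
    rw [hk m]
    have := hcomp (Finsupp.single m 1)
    simpa [Φ, Ψ] using this.symm

end ExtensionOfScalars

/-! ### Gradings described by their projections -/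

section Grading

variable {M : Type u} [AddCommGroup M]

/-- The projection of a graded abelian group onto its homogeneous part of degree `n`. -/
def degProj {d : ℤ → AddSubgroup M} (hd : DirectSum.IsInternal d) (n : ℤ) : M →+ M :=
  ((d n).subtype.comp (DFinsupp.evalAddMonoidHom n)).comp
    (AddEquiv.ofBijective (DirectSum.coeAddMonoidHom d) hd).symm.toAddMonoidHom

theorem degProj_mem {d : ℤ → AddSubgroup M} (hd : DirectSum.IsInternal d) (n : ℤ) (m : M) :
    degProj hd n m ∈ d n := SetLike.coe_mem _

theorem degProj_coe {d : ℤ → AddSubgroup M} (hd : DirectSum.IsInternal d)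
    (f : DirectSum ℤ fun n => d n) (n : ℤ) :
    degProj hd n (DirectSum.coeAddMonoidHom d f) = f n := by
  have : (AddEquiv.ofBijective (DirectSum.coeAddMonoidHom d) hd).symm
      (DirectSum.coeAddMonoidHom d f) = f :=
    (AddEquiv.ofBijective (DirectSum.coeAddMonoidHom d) hd).symm_apply_apply f
  change ((AddEquiv.ofBijective (DirectSum.coeAddMonoidHom d) hd).symm
      (DirectSum.coeAddMonoidHom d f) n : M) = f n
  rw [this]

theorem degProj_self {d : ℤ → AddSubgroup M} (hd : DirectSum.IsInternal d) {n : ℤ} {m : M}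
    (hm : m ∈ d n) : degProj hd n m = m := by
  have := degProj_coe hd (DirectSum.of (fun n => d n) n ⟨m, hm⟩) n
  rwa [DirectSum.coeAddMonoidHom_of, DirectSum.of_eq_same] at this

theorem degProj_of_ne {d : ℤ → AddSubgroup M} (hd : DirectSum.IsInternal d) {n k : ℤ}
    (hn : k ≠ n) {m : M} (hm : m ∈ d k) : degProj hd n m = 0 := by
  have := degProj_coe hd (DirectSum.of (fun n => d n) k ⟨m, hm⟩) n
  rwa [DirectSum.coeAddMonoidHom_of, DirectSum.of_eq_of_ne _ _ _ hn.symm] at this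

theorem exists_eq_sum_degProj {d : ℤ → AddSubgroup M} (hd : DirectSum.IsInternal d) (m : M) :
    ∃ s : Finset ℤ, m = ∑ n ∈ s, degProj hd n m := by
  classical
  obtain ⟨f, rfl⟩ := hd.surjective m
  refine ⟨f.support, ?_⟩
  conv_lhs => rw [← DirectSum.sum_support_of f, map_sum]
  refine Finset.sum_congr rfl fun n _ => ?_
  rw [degProj_coe, DirectSum.coeAddMonoidHom_of]

/-- The maps `p n` recover the components of a formal sum from its value, which gives injectivity;
`hspan` gives surjectivity. -/
theorem isInternal_of_proj {d : ℤ → AddSubgroup M} (p : ℤ → M →+ M)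
    (hself : ∀ n, ∀ m ∈ d n, p n m = m) (hne : ∀ n k, k ≠ n → ∀ m ∈ d k, p n m = 0)
    (hspan : ∀ m, m ∈ ⨆ n, d n) : DirectSum.IsInternal d := by
  classical
  constructor
  · rw [injective_iff_map_eq_zero]
    intro f hf
    ext n
    have h1 : (p n).comp (DirectSum.coeAddMonoidHom d) =
        (d n).subtype.comp (DFinsupp.evalAddMonoidHom n) := by
      refine DirectSum.addHom_ext' fun k => AddMonoidHom.ext fun m => ?_
      simp only [AddMonoidHom.comp_apply, DirectSum.coeAddMonoidHom_of]
      change p n m = ((DirectSum.of (fun n => d n) k m) n : M)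
      rcases eq_or_ne k n with rfl | h
      · rw [DirectSum.of_eq_same, hself k m m.2]
      · rw [DirectSum.of_eq_of_ne _ _ _ h.symm, hne n k h m m.2]
        rfl
    have h2 := DFunLike.congr_fun h1 f
    rw [AddMonoidHom.comp_apply, hf, map_zero] at h2
    exact h2.symm
  · rw [← AddMonoidHom.range_eq_top, eq_top_iff]
    refine fun m _ => (iSup_le fun n x hx => ?_ : ⨆ n, d n ≤ _) (hspan m)
    exact ⟨DirectSum.of (fun n => d n) n ⟨x, hx⟩, DirectSum.coeAddMonoidHom_of _ _ _⟩

theorem map_degProj {M' : Type u} [AddCommGroup M'] {d : ℤ → AddSubgroup M}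
    {d' : ℤ → AddSubgroup M'} (hd : DirectSum.IsInternal d) (hd' : DirectSum.IsInternal d')
    (f : M →+ M') (hf : ∀ n, ∀ m ∈ d n, f m ∈ d' n) (n : ℤ) (m : M) :
    f (degProj hd n m) = degProj hd' n (f m) := by
  obtain ⟨s, hs⟩ := exists_eq_sum_degProj hd m
  have key : ∀ k, f (degProj hd n (degProj hd k m)) = degProj hd' n (f (degProj hd k m)) := by
    intro k
    have hk := degProj_mem hd k m
    rcases eq_or_ne k n with rfl | h
    · rw [degProj_self hd hk, degProj_self hd' (hf _ _ hk)]
    · rw [degProj_of_ne hd h hk, degProj_of_ne hd' h (hf _ _ hk), map_zero]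
  rw [hs, map_sum, map_sum, map_sum, map_sum]
  exact Finset.sum_congr rfl fun k _ => key k

/-- A kernel stable under the projections is a graded subgroup, so the projections descend to the
quotient. This grades the colimits below. -/
theorem isInternal_map_of_surjective {M' : Type u} [AddCommGroup M']
    {d : ℤ → AddSubgroup M} (hd : DirectSum.IsInternal d)
    (π : M →+ M') (hπ : Function.Surjective π)
    (hker : ∀ n, ∀ m ∈ π.ker, degProj hd n m ∈ π.ker) :
    DirectSum.IsInternal fun n => (d n).map π := by
  let p : ℤ → M' →+ M' := fun n =>
    π.liftOfSurjective hπ ⟨π.comp (degProj hd n), fun m hm => hker n m hm⟩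
  have hp : ∀ n m, p n (π m) = π (degProj hd n m) := fun n m =>
    π.liftOfRightInverse_comp_apply _ _ _ m
  refine isInternal_of_proj p ?_ ?_ ?_
  · rintro n _ ⟨m, hm, rfl⟩
    rw [hp, degProj_self hd hm]
  · rintro n k h _ ⟨m, hm, rfl⟩
    rw [hp, degProj_of_ne hd h hm, map_zero]
  · intro m'
    obtain ⟨m, rfl⟩ := hπ m'
    obtain ⟨s, hs⟩ := exists_eq_sum_degProj hd m
    rw [hs, map_sum]
    exact sum_mem fun n _ => AddSubgroup.mem_iSup_of_mem n ⟨_, degProj_mem hd n m, rfl⟩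

end Grading

/-! ### Closing small sets under finitary operations -/

section Closure

open Cardinal

theorem mk_iUnion_le_of_le {E ι : Type u} {κ : Cardinal.{u}} (hκ : ℵ₀ ≤ κ) (hι : #ι ≤ κ)
    {F : ι → Set E} (hF : ∀ i, #(F i) ≤ κ) : #(⋃ i, F i) ≤ κ :=
  (mk_iUnion_le F).trans
    ((mul_le_mul' hι (ciSup_le' hF)).trans (mul_eq_self hκ).le)

theorem mk_finset_le_of_le {E : Type u} {κ : Cardinal.{u}} (hκ : ℵ₀ ≤ κ) (hE : #E ≤ κ) :
    #(Finset E) ≤ κ := by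
  rcases finite_or_infinite E with h | h
  · exact (lt_aleph0_of_finite _).le.trans hκ
  · rwa [mk_finset_of_infinite]

/-- Iterating one round of closure countably often suffices because the operations are finitary: a
finite subset of the union already lies in one stage, and the next stage contains its closure. -/
theorem exists_closed_superset {E : Type u} {κ : Cardinal.{u}} (hκ : ℵ₀ ≤ κ)
    (C : Finset E → Set E) (hC : ∀ s, #(C s) ≤ κ) (S : Set E) (hS : #S ≤ κ) :
    ∃ T : Set E, S ⊆ T ∧ #T ≤ κ ∧ ∀ s : Finset E, (s : Set E) ⊆ T → C s ⊆ T := by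
  classical
  let step : Set E → Set E := fun T =>
    T ∪ ⋃ s : Finset T, C (s.map (Function.Embedding.subtype _))
  have hstep : ∀ T : Set E, #T ≤ κ → #(step T) ≤ κ := fun T hT =>
    (mk_union_le _ _).trans (add_le_of_le hκ hT
      (mk_iUnion_le_of_le hκ (mk_finset_le_of_le hκ hT) fun s => hC _))
  let F : ℕ → Set E := fun n => step^[n] S
  have hF : ∀ n, F (n + 1) = step (F n) := fun n => Function.iterate_succ_apply' step n S
  have hmono : Monotone F := monotone_nat_of_le_succ fun n => by
    rw [hF]; exact Set.subset_union_left
  have hcard : ∀ n, #(F n) ≤ κ := by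
    intro n
    induction n with
    | zero => exact hS
    | succ n ih => rw [hF]; exact hstep _ ih
  refine ⟨⋃ n, F n, Set.subset_iUnion F 0, ?_, ?_⟩
  -- The stages are indexed by a lift of `ℕ` to the universe of `E`, so that all cardinals compared
  -- live in one universe.
  · have := mk_iUnion_le_of_le (ι := ULift.{u} ℕ) hκ (by simpa using hκ)
      (F := fun n => F n.down) fun n => hcard _
    rwa [show (⋃ n : ULift.{u} ℕ, F n.down) = ⋃ n, F n from
      Equiv.ulift.surjective.iUnion_comp F] at this
  · intro s hs
    choose! n hn using fun e (he : e ∈ s) => Set.mem_iUnion.1 (hs he)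
    have hsub : (s : Set E) ⊆ F (s.sup n) := fun e he => hmono (Finset.le_sup he) (hn e he)
    refine fun e he => Set.mem_iUnion.2 ⟨s.sup n + 1, ?_⟩
    rw [hF]
    refine Or.inr (Set.mem_iUnion.2 ⟨s.subtype (· ∈ F (s.sup n)), ?_⟩)
    rwa [Finset.subtype_map_of_mem fun e he => hsub he]

theorem mk_finsupp_support_le {M B : Type u} [Zero B] {κ : Cardinal.{u}} (hκ : ℵ₀ ≤ κ)
    (hB : #B ≤ κ) (s : Set M) (hs : s.Finite) :
    #{w : M →₀ B // (w.support : Set M) ⊆ s} ≤ κ := by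
  have hinj : Function.Injective
      fun (w : {w : M →₀ B // (w.support : Set M) ⊆ s}) (m : s) => w.1 m := by
    intro w w' h
    refine Subtype.ext (Finsupp.ext fun m => ?_)
    by_cases hm : m ∈ s
    · exact congrFun h ⟨m, hm⟩
    · rw [Finsupp.notMem_support_iff.1 fun h1 => hm (w.2 h1),
        Finsupp.notMem_support_iff.1 fun h1 => hm (w'.2 h1)]
  refine (mk_le_of_injective hinj).trans ?_
  rw [← power_def]
  refine (power_le_power_right hB).trans ?_
  obtain ⟨n, hn⟩ := lt_aleph0.1 hs.lt_aleph0
  rw [hn]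
  exact_mod_cast power_nat_le hκ

end Closure

/-! ### Structural arrows and graded subdiagrams -/

variable {G : Type u} [CommGroup G] [TopologicalSpace G]

/-- The horizontal and the vertical arrows of the indexing poset. -/
def IsStructArrow (x y : QuotPair G) : Prop := x.L = y.L ∨ x.K = y.K

/-- This treats the two conditions uniformly: from here on only a fixed class of arrows matters, not
their direction. -/
theorem isQuasiCoherent_inf_isExtended_iff (M : RMod G) :
    (IsQuasiCoherent G ⊓ IsExtended G) M ↔
      ∀ (x y : QuotPair G) (h : x ≤ y), IsStructArrow x y →
        IsExtensionOfScalars (ringMap h) (M.map h) := by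
  constructor
  · rintro ⟨h1, h2⟩ ⟨K, L, hx⟩ ⟨K', L', hy⟩ h (e | e)
    · obtain rfl : L = L' := e
      exact h1 L K K' hx h.1
    · obtain rfl : K = K' := e
      exact h2 L' L K h.2 hx
  · intro h
    exact ⟨fun L K H _ _ => h _ _ _ (Or.inl rfl), fun L K H _ _ => h _ _ _ (Or.inr rfl)⟩

namespace RMod

/-- The projection to the homogeneous part of degree `n`. -/
def proj (M : RMod G) (x : QuotPair G) (n : ℤ) : M.obj x →+ M.obj x :=
  degProj (M.isInternal x) n

theorem Hom.app_proj {M N : RMod G} (f : M.Hom N) (x : QuotPair G) (n : ℤ) (m : M.obj x) :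
    f.app x (M.proj x n m) = N.proj x n (f.app x m) :=
  map_degProj (M.isInternal x) (N.isInternal x) (f.app x).toAddMonoidHom
    (fun n m hm => f.app_mem x n m hm) n m

theorem proj_of_mem_deg (M : RMod G) {x : QuotPair G} {n : ℤ} {m : M.obj x}
    (hm : m ∈ M.deg x n) : M.proj x n m = m := degProj_self _ hm

theorem proj_of_mem_deg_of_ne (M : RMod G) {x : QuotPair G} {n k : ℤ} (h : k ≠ n) {m : M.obj x}
    (hm : m ∈ M.deg x k) : M.proj x n m = 0 := degProj_of_ne _ h hm

/-- A graded subdiagram of an `R`-module. -/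
structure Sub (M : RMod G) where
  /-- the underlying submodules -/
  carrier : ∀ x, Submodule (R x) (M.obj x)
  map_mem : ∀ {x y : QuotPair G} (h : x ≤ y), ∀ m ∈ carrier x, M.map h m ∈ carrier y
  proj_mem : ∀ (x : QuotPair G) (n : ℤ), ∀ m ∈ carrier x, M.proj x n m ∈ carrier x

namespace Sub

variable {M : RMod G} (P : M.Sub)

/-- A graded subdiagram as an `R`-module. -/
def toRMod : RMod G where
  obj x := P.carrier x
  deg x n := (M.deg x n).comap (P.carrier x).subtype.toAddMonoidHom
  isInternal x := by
    refine isInternal_of_proj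
      (fun n => ((M.proj x n).comp (P.carrier x).subtype.toAddMonoidHom).codRestrict
        (P.carrier x) fun m => P.proj_mem x n _ m.2) ?_ ?_ ?_
    · intro n m hm
      exact Subtype.ext (M.proj_of_mem_deg hm)
    · intro n k h m hm
      exact Subtype.ext (M.proj_of_mem_deg_of_ne h hm)
    · intro m
      obtain ⟨s, hs⟩ := exists_eq_sum_degProj (M.isInternal x) (m : M.obj x)
      have : m = ∑ n ∈ s, (⟨M.proj x n m, P.proj_mem x n _ m.2⟩ : P.carrier x) := by
        refine Subtype.ext ?_
        rw [AddSubmonoidClass.coe_finsetSum]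
        exact hs
      rw [this]
      refine sum_mem fun n _ => AddSubgroup.mem_iSup_of_mem n ?_
      exact degProj_mem (M.isInternal x) n _
  smul_mem x i j s m hs hm := M.smul_mem x i j s m hs hm
  map h :=
    { toFun := fun m => ⟨M.map h m, P.map_mem h _ m.2⟩
      map_add' := fun m m' => Subtype.ext (map_add (M.map h) _ _)
      map_smul' := fun a m => Subtype.ext (map_smulₛₗ (M.map h) _ _) }
  map_mem h n m hm := M.map_mem h n m hm
  map_refl x m := Subtype.ext (M.map_refl x m)
  map_trans h h' m := Subtype.ext (M.map_trans h h' m)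

/-- The inclusion of a graded subdiagram. -/
def ι : P.toRMod.Hom M where
  app x := (P.carrier x).subtype
  app_mem _ _ _ h := h
  naturality _ _ := rfl

/-- The inclusion between graded subdiagrams. -/
def inclusion {P P' : M.Sub} (h : ∀ x, P.carrier x ≤ P'.carrier x) : P.toRMod.Hom P'.toRMod where
  app x := Submodule.inclusion (h x)
  app_mem _ _ _ hm := hm
  naturality _ _ := rfl

/-- The corestriction of a map to a graded subdiagram that contains its image. -/
def codRestrict {N : RMod G} (f : N.Hom M) (h : ∀ x n, f.app x n ∈ P.carrier x) :
    N.Hom P.toRMod where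
  app x := (f.app x).codRestrict (P.carrier x) (h x)
  app_mem x n m hm := f.app_mem x n m hm
  naturality h' m := Subtype.ext (f.naturality h' m)

end Sub

end RMod

/-! ### Small coherent subdiagrams -/

open Cardinal in
variable (G) in
/-- The cardinal that bounds the size of the generating objects. -/
def sizeBound : Cardinal.{u} := max ℵ₀ #(Σ x : QuotPair G, R x)

open Cardinal in
theorem aleph0_le_sizeBound : ℵ₀ ≤ sizeBound G := le_max_left _ _

open Cardinal in
theorem mk_R_le_sizeBound (x : QuotPair G) : #(R x) ≤ sizeBound G :=
  (mk_le_of_injective (sigma_mk_injective (i := x))).trans (le_max_right _ _)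

open Cardinal in
theorem mk_quotPair_le_sizeBound : #(QuotPair G) ≤ sizeBound G :=
  -- Every `R x` contains `0`, so the total set of ring elements also bounds the number of objects.
  (mk_le_of_surjective (f := fun e : Σ x : QuotPair G, R x => e.1)
    fun x => ⟨⟨x, 0⟩, rfl⟩).trans (le_max_right _ _)

namespace RMod

open Cardinal in
/-- An `R`-module with few elements. -/
def IsSmall (M : RMod G) : Prop := #(Σ x, M.obj x) ≤ sizeBound G

open Cardinal in
/-- The downward Löwenheim–Skolem property of quasi-coherent extended `R`-modules. -/
theorem exists_small_sub (M : RMod G) (hM : (IsQuasiCoherent G ⊓ IsExtended G) M)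
    (S : Set (Σ x, M.obj x)) (hS : #S ≤ sizeBound G) :
    ∃ P : M.Sub, (∀ e ∈ S, e.2 ∈ P.carrier e.1) ∧ P.toRMod.IsSmall ∧
      (IsQuasiCoherent G ⊓ IsExtended G) P.toRMod := by
  classical
  rw [isQuasiCoherent_inf_isExtended_iff] at hM
  have hκ := aleph0_le_sizeBound (G := G)
  -- Finite witnesses for generation: the elements at `x` whose images generate `n`.
  have hgen : ∀ (x y : QuotPair G) (h : x ≤ y) (_ : IsStructArrow x y) (n : M.obj y),
      ∃ V : Finset (M.obj x), n ∈ Submodule.span (R y) (M.map h '' (V : Set (M.obj x))) := by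
    intro x y h ha n
    have h1 : n ∈ Submodule.span (R y) (Set.range (M.map h)) := by
      rw [(hM x y h ha).span_range_eq_top]; trivial
    obtain ⟨w, rfl⟩ := Finsupp.mem_span_range_iff_exists_finsupp.1 h1
    exact ⟨w.support, sum_mem fun m hm => Submodule.smul_mem _ _
      (Submodule.subset_span ⟨m, hm, rfl⟩)⟩
  -- Finite witnesses for relations: the elements at `x` used in deriving that `w` vanishes. The
  -- empty set is a dummy value when `w` does not vanish.
  have hrel : ∀ (x y : QuotPair G) (h : x ≤ y) (_ : IsStructArrow x y) (w : M.obj x →₀ R y),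
      ∃ W : Finset (M.obj x), Finsupp.linearCombination (R y) (M.map h) w = 0 →
        w ∈ tensorRel (ringMap h) (W : Set (M.obj x)) := by
    intro x y h ha w
    by_cases hw : Finsupp.linearCombination (R y) (M.map h) w = 0
    · obtain ⟨W, hW⟩ := exists_finset_mem_tensorRel ((hM x y h ha).mem_tensorRel hw)
      exact ⟨W, fun _ => hW⟩
    · exact ⟨∅, fun h => absurd h hw⟩
  choose V hV using hgen
  choose W hW using hrel
  let fib : Finset (Σ x, M.obj x) → ∀ x, Set (M.obj x) := fun s x => Sigma.mk x ⁻¹' (s : Set _)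
  have hfib : ∀ s x, (fib s x).Finite := fun s x =>
    s.finite_toSet.preimage sigma_mk_injective.injOn
  -- Five closure operations: `C1` makes a submodule at each object, `C2` a subdiagram, `C3` a
  -- graded one; `C4` and `C5` add the witnesses for generators and for relations that keep the
  -- subdiagram coherent.
  let C1 : Finset (Σ x, M.obj x) → Set (Σ x, M.obj x) := fun s =>
    ⋃ x, ⋃ w : {w : M.obj x →₀ R x // (w.support : Set _) ⊆ fib s x},
      {⟨x, Finsupp.linearCombination (R x) id w.1⟩}
  let C2 : Finset (Σ x, M.obj x) → Set (Σ x, M.obj x) := fun s =>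
    ⋃ e : {e // e ∈ s}, ⋃ y : {y // e.1.1 ≤ y}, {⟨y.1, M.map y.2 e.1.2⟩}
  let C3 : Finset (Σ x, M.obj x) → Set (Σ x, M.obj x) := fun s =>
    ⋃ e : {e // e ∈ s}, Set.range fun n : ℤ => ⟨e.1.1, M.proj e.1.1 n e.1.2⟩
  let C4 : Finset (Σ x, M.obj x) → Set (Σ x, M.obj x) := fun s =>
    ⋃ e : {e // e ∈ s}, ⋃ x : {x // ∃ _ : x ≤ e.1.1, IsStructArrow x e.1.1},
      Sigma.mk x.1 '' (V x.1 e.1.1 x.2.1 x.2.2 e.1.2 : Set (M.obj x.1))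
  let C5 : Finset (Σ x, M.obj x) → Set (Σ x, M.obj x) := fun s =>
    ⋃ x, ⋃ y : {y // ∃ _ : x ≤ y, IsStructArrow x y},
      ⋃ w : {w : M.obj x →₀ R y.1 // (w.support : Set _) ⊆ fib s x},
        Sigma.mk x '' (W x y.1 y.2.1 y.2.2 w.1 : Set (M.obj x))
  have hsub : ∀ p : QuotPair G → Prop, #{x // p x} ≤ sizeBound G := fun p =>
    (mk_subtype_le _).trans mk_quotPair_le_sizeBound
  have hfin : ∀ s : Finset (Σ x, M.obj x), #{e // e ∈ s} ≤ sizeBound G := fun s =>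
    (lt_aleph0_of_finite _).le.trans hκ
  have himg : ∀ (x : QuotPair G) (s : Finset (M.obj x)),
      #(Sigma.mk (β := M.obj) x '' (s : Set (M.obj x))) ≤ sizeBound G := fun x s =>
    (((s.finite_toSet.image _).countable).le_aleph0).trans hκ
  have hsing : ∀ e : Σ x, M.obj x, #({e} : Set (Σ x, M.obj x)) ≤ sizeBound G := fun e =>
    ((Set.countable_singleton e).le_aleph0).trans hκ
  obtain ⟨T, hST, hT, hclosed⟩ := exists_closed_superset hκ
    (fun s => C1 s ∪ C2 s ∪ C3 s ∪ C4 s ∪ C5 s) (fun s => by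
      refine (mk_union_le _ _).trans (add_le_of_le hκ ((mk_union_le _ _).trans
        (add_le_of_le hκ ((mk_union_le _ _).trans (add_le_of_le hκ ((mk_union_le _ _).trans
        (add_le_of_le hκ ?_ ?_)) ?_)) ?_)) ?_)
      · exact mk_iUnion_le_of_le hκ mk_quotPair_le_sizeBound fun x => mk_iUnion_le_of_le hκ
          (mk_finsupp_support_le hκ (mk_R_le_sizeBound x) _ (hfib s x)) fun w => hsing _
      · exact mk_iUnion_le_of_le hκ (hfin s) fun e => mk_iUnion_le_of_le hκ (hsub _)
          fun y => hsing _
      · exact mk_iUnion_le_of_le hκ (hfin s) fun e =>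
          ((Set.countable_range _).le_aleph0).trans hκ
      · exact mk_iUnion_le_of_le hκ (hfin s) fun e => mk_iUnion_le_of_le hκ (hsub _)
          fun x => himg _ _
      · exact mk_iUnion_le_of_le hκ mk_quotPair_le_sizeBound fun x => mk_iUnion_le_of_le hκ
          (hsub _) fun y => mk_iUnion_le_of_le hκ
          (mk_finsupp_support_le hκ (mk_R_le_sizeBound y.1) _ (hfib s x)) fun w => himg _ _) S hS
  have hlin : ∀ (x : QuotPair G) (w : M.obj x →₀ R x),
      (∀ m ∈ w.support, (⟨x, m⟩ : Σ x, M.obj x) ∈ T) →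
        (⟨x, Finsupp.linearCombination (R x) id w⟩ : Σ x, M.obj x) ∈ T := by
    intro x w hw
    refine hclosed (w.support.map ⟨Sigma.mk x, sigma_mk_injective⟩) ?_
      (Or.inl (Or.inl (Or.inl (Or.inl (Set.mem_iUnion.2 ⟨x, Set.mem_iUnion.2 ⟨⟨w, ?_⟩, rfl⟩⟩)))))
    · intro e he
      obtain ⟨m, hm, rfl⟩ := Finset.mem_map.1 he
      exact hw m hm
    · intro m hm
      exact Finset.mem_map.2 ⟨m, hm, rfl⟩
  have hone : ∀ e : Σ x, M.obj x, e ∈ T → (({e} : Finset _) : Set _) ⊆ T := fun e he => by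
    simpa using he
  have hself : ∀ e : Σ x, M.obj x, e ∈ ({e} : Finset (Σ x, M.obj x)) := fun e =>
    Finset.mem_singleton_self e
  let P : M.Sub :=
    { carrier := fun x =>
        { carrier := {m | (⟨x, m⟩ : Σ x, M.obj x) ∈ T}
          zero_mem' := by
            have := hlin x 0 (by simp)
            rwa [map_zero] at this
          add_mem' := by
            intro m m' hm hm'
            have := hlin x (Finsupp.single m 1 + Finsupp.single m' 1) (fun k hk => by
              rcases Finset.mem_union.1 (Finsupp.support_add hk) with h | h
              · rw [Finset.mem_singleton.1 (Finsupp.support_single_subset h)]; exact hm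
              · rw [Finset.mem_singleton.1 (Finsupp.support_single_subset h)]; exact hm')
            simpa using this
          smul_mem' := by
            intro a m hm
            have := hlin x (Finsupp.single m a) (fun k hk => by
              rw [Finset.mem_singleton.1 (Finsupp.support_single_subset hk)]; exact hm)
            simpa using this }
      map_mem := fun {x y} h m hm => hclosed {⟨x, m⟩} (hone _ hm)
        (Or.inl (Or.inl (Or.inl (Or.inr (Set.mem_iUnion.2 ⟨⟨⟨x, m⟩, hself _⟩,
          Set.mem_iUnion.2 ⟨⟨y, h⟩, rfl⟩⟩)))))
      proj_mem := fun x n m hm => hclosed {⟨x, m⟩} (hone _ hm)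
        (Or.inl (Or.inl (Or.inr (Set.mem_iUnion.2 ⟨⟨⟨x, m⟩, hself _⟩, ⟨n, rfl⟩⟩)))) }
  refine ⟨P, fun e he => hST he, ?_, ?_⟩
  · refine (mk_le_of_injective (β := T) (f := fun e => ⟨⟨e.1, e.2.1⟩, e.2.2⟩) ?_).trans hT
    rintro ⟨x, m, hm⟩ ⟨x', m', hm'⟩ h
    obtain ⟨rfl, h⟩ := Sigma.mk.inj (Subtype.mk.inj h)
    obtain rfl := eq_of_heq h
    rfl
  · rw [isQuasiCoherent_inf_isExtended_iff]
    intro x y h ha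
    refine isExtensionOfScalars_of_submodule (M.map h) (P.carrier x) (P.carrier y)
      (P.toRMod.map h) (fun _ => rfl) ?_ ?_
    · intro n hn
      refine Submodule.span_mono (Set.image_mono fun m hm => ?_) (hV x y h ha n)
      exact hclosed {⟨y, n⟩} (hone _ hn) (Or.inl (Or.inr (Set.mem_iUnion.2 ⟨⟨⟨y, n⟩, hself _⟩,
        Set.mem_iUnion.2 ⟨⟨x, h, ha⟩, ⟨m, hm, rfl⟩⟩⟩)))
    · intro w hw h0
      refine tensorRel_mono (fun m hm => ?_) (hW x y h ha w h0)
      refine hclosed (w.support.map ⟨Sigma.mk x, sigma_mk_injective⟩) ?_ (Or.inr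
        (Set.mem_iUnion.2 ⟨x, Set.mem_iUnion.2 ⟨⟨y, h, ha⟩, Set.mem_iUnion.2 ⟨⟨w, ?_⟩,
          ⟨m, hm, rfl⟩⟩⟩⟩))
      · intro e he
        obtain ⟨m, hm, rfl⟩ := Finset.mem_map.1 he
        exact hw hm
      · intro m hm
        exact Finset.mem_map.2 ⟨m, hm, rfl⟩

/-! ### Colimits of `R`-modules -/

open DirectSum

section Colimit

/-- The degree `n` part of the direct sum of a family of `R`-modules. -/
def sumDeg {I : Type u} (X : I → RMod G) (x : QuotPair G) (n : ℤ) :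
    AddSubgroup (⨁ i, (X i).obj x) where
  carrier := {f | ∀ i, f i ∈ (X i).deg x n}
  zero_mem' _ := zero_mem _
  add_mem' hf hg i := by
    rw [DirectSum.add_apply]
    exact add_mem (hf i) (hg i)
  neg_mem' hf i := neg_mem (hf i)

open scoped Classical in
theorem of_mem_sumDeg {I : Type u} (X : I → RMod G) (x : QuotPair G) (n : ℤ) (i : I)
    {m : (X i).obj x} (hm : m ∈ (X i).deg x n) :
    of (fun i => (X i).obj x) i m ∈ sumDeg X x n := by
  intro k
  rcases eq_or_ne k i with rfl | h
  · rwa [of_eq_same]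
  · rw [of_eq_of_ne _ _ _ h]
    exact zero_mem _

open scoped Classical in
theorem isInternal_sumDeg {I : Type u} (X : I → RMod G) (x : QuotPair G) :
    IsInternal (sumDeg X x) := by
  refine isInternal_of_proj (fun n => DirectSum.map fun i => (X i).proj x n) ?_ ?_ ?_
  · intro n f hf
    ext i
    rw [DirectSum.map_apply, (X i).proj_of_mem_deg (hf i)]
  · intro n k h f hf
    ext i
    rw [DirectSum.map_apply, (X i).proj_of_mem_deg_of_ne h (hf i), DirectSum.zero_apply]
  · intro f
    induction f using DirectSum.induction_on with
    | zero => exact zero_mem _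
    | of i m =>
      obtain ⟨s, hs⟩ := exists_eq_sum_degProj ((X i).isInternal x) m
      rw [hs, map_sum]
      exact sum_mem fun n _ => AddSubgroup.mem_iSup_of_mem n
        (of_mem_sumDeg X x n i (degProj_mem _ n m))
    | add f g hf hg => exact add_mem hf hg

open scoped Classical in
theorem degProj_sumDeg_of {I : Type u} (X : I → RMod G) (x : QuotPair G) (n : ℤ) (i : I)
    (m : (X i).obj x) :
    degProj (isInternal_sumDeg X x) n (of (fun i => (X i).obj x) i m) =
      of (fun i => (X i).obj x) i ((X i).proj x n m) :=
  (map_degProj ((X i).isInternal x) (isInternal_sumDeg X x) (of (fun i => (X i).obj x) i)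
    (fun n _ hm => of_mem_sumDeg X x n i hm) n m).symm

/-- The structure maps of the direct sum of a family of `R`-modules. -/
def sumMap {I : Type u} (X : I → RMod G) {x y : QuotPair G} (h : x ≤ y) :
    (⨁ i, (X i).obj x) →ₛₗ[ringMap h] ⨁ i, (X i).obj y where
  toFun := DirectSum.map fun i => ((X i).map h).toAddMonoidHom
  map_add' := map_add _
  map_smul' a f := by
    ext i
    rw [DirectSum.map_apply, DirectSum.smul_apply, DirectSum.smul_apply, DirectSum.map_apply]
    exact map_smulₛₗ ((X i).map h) a (f i)

theorem sumMap_apply {I : Type u} (X : I → RMod G) {x y : QuotPair G} (h : x ≤ y)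
    (f : ⨁ i, (X i).obj x) (i : I) : sumMap X h f i = (X i).map h (f i) :=
  DirectSum.map_apply _ _ _

open scoped Classical in
theorem sumMap_of {I : Type u} (X : I → RMod G) {x y : QuotPair G} (h : x ≤ y)
    (i : I) (m : (X i).obj x) : sumMap X h (of (fun i => (X i).obj x) i m) =
      of (fun i => (X i).obj y) i ((X i).map h m) :=
  DirectSum.map_of _ _ _

variable {I : Type u} (X : I → RMod G) (J : ∀ i j, Set ((X i).Hom (X j)))

open scoped Classical in
/-- The relations that define the colimit of the family `X` along the maps in `J`. -/
def colimRel (x : QuotPair G) : Submodule (R x) (⨁ i, (X i).obj x) :=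
  Submodule.span (R x) {w | ∃ i j, ∃ u ∈ J i j, ∃ m : (X i).obj x,
    w = of (fun i => (X i).obj x) j (u.app x m) - of (fun i => (X i).obj x) i m}

open scoped Classical in
theorem of_sub_of_mem_colimRel (x : QuotPair G) {i j : I} {u : (X i).Hom (X j)} (hu : u ∈ J i j)
    (m : (X i).obj x) :
    of (fun i => (X i).obj x) j (u.app x m) - of (fun i => (X i).obj x) i m ∈ colimRel X J x :=
  Submodule.subset_span ⟨i, j, u, hu, m, rfl⟩

-- The relations form a graded submodule because the maps in `J` commute with the projections.
open scoped Classical in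
theorem degProj_mem_colimRel (x : QuotPair G) (n : ℤ) {w : ⨁ i, (X i).obj x}
    (hw : w ∈ colimRel X J x) :
    degProj (isInternal_sumDeg X x) n w ∈ colimRel X J x := by
  refine Submodule.closure_induction (p := fun w _ =>
    degProj (isInternal_sumDeg X x) n w ∈ colimRel X J x) ?_ ?_ ?_ hw
  · rw [map_zero]; exact zero_mem _
  · intro f g _ _ hf hg
    rw [map_add]
    exact add_mem hf hg
  · rintro a _ ⟨i, j, u, hu, m, rfl⟩
    -- Projections are additive but not `R x`-linear, so the scalar is first absorbed into the
    -- element `m`.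
    have e : a • (of (fun i => (X i).obj x) j (u.app x m) - of (fun i => (X i).obj x) i m) =
        of (fun i => (X i).obj x) j (u.app x (a • m)) - of (fun i => (X i).obj x) i (a • m) := by
      rw [smul_sub, map_smul]
      exact congrArg₂ _ (map_smul (lof (R x) I (fun i => (X i).obj x) j) a _).symm
        (map_smul (lof (R x) I (fun i => (X i).obj x) i) a _).symm
    rw [e, map_sub, degProj_sumDeg_of, degProj_sumDeg_of, ← u.app_proj]
    exact of_sub_of_mem_colimRel X J x hu _

theorem colimRel_le_comap {x y : QuotPair G} (h : x ≤ y) :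
    colimRel X J x ≤ (colimRel X J y).comap (sumMap X h) := by
  classical
  refine Submodule.span_le.2 ?_
  rintro _ ⟨i, j, u, hu, m, rfl⟩
  change sumMap X h _ ∈ colimRel X J y
  rw [map_sub, sumMap_of, sumMap_of, ← u.naturality]
  exact of_sub_of_mem_colimRel X J y hu _

/-- The colimit of the family `X` along the maps in `J`. -/
def colim : RMod G where
  obj x := (⨁ i, (X i).obj x) ⧸ colimRel X J x
  deg x n := (sumDeg X x n).map (colimRel X J x).mkQ.toAddMonoidHom
  isInternal x := by
    refine isInternal_map_of_surjective (isInternal_sumDeg X x) _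
      (Submodule.mkQ_surjective _) fun n m hm => ?_
    exact (Submodule.Quotient.mk_eq_zero _).2 (degProj_mem_colimRel X J x n
      ((Submodule.Quotient.mk_eq_zero _).1 hm))
  smul_mem x i j s := by
    rintro _ hs ⟨f, hf, rfl⟩
    exact ⟨s • f, fun k => (X k).smul_mem x i j s _ hs (hf k), rfl⟩
  map h := Submodule.mapQ _ _ (sumMap X h) (colimRel_le_comap X J h)
  map_mem h n := by
    rintro _ ⟨f, hf, rfl⟩
    refine ⟨sumMap X h f, fun k => ?_, rfl⟩
    rw [sumMap_apply]
    exact (X k).map_mem h n _ (hf k)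
  map_refl x m := by
    obtain ⟨f, rfl⟩ := Submodule.mkQ_surjective _ m
    refine congrArg (Submodule.mkQ _) (DFinsupp.ext fun i => ?_)
    exact (sumMap_apply X _ f i).trans ((X i).map_refl x _)
  map_trans h h' m := by
    obtain ⟨f, rfl⟩ := Submodule.mkQ_surjective _ m
    refine congrArg (Submodule.mkQ _) (DFinsupp.ext fun i => ?_)
    change sumMap X h' (sumMap X h f) i = sumMap X (h.trans h') f i
    rw [sumMap_apply, sumMap_apply, sumMap_apply, (X i).map_trans]

open scoped Classical in
/-- The maps to the colimit. -/
def colimι (i : I) : (X i).Hom (colim X J) where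
  app x := (colimRel X J x).mkQ ∘ₗ lof (R x) I (fun i => (X i).obj x) i
  app_mem x n m hm := ⟨_, of_mem_sumDeg X x n i hm, rfl⟩
  naturality {x y} h m := by
    refine congrArg (colimRel X J y).mkQ ?_
    exact (sumMap_of X h i m).symm

theorem colimι_app_app {i j : I} {u : (X i).Hom (X j)} (hu : u ∈ J i j) (x : QuotPair G)
    (m : (X i).obj x) : (colimι X J j).app x (u.app x m) = (colimι X J i).app x m := by
  classical
  exact (Submodule.Quotient.eq _).2 (of_sub_of_mem_colimRel X J x hu m)

theorem colim_linearMap_ext {x : QuotPair G} {Z : Type*} [AddCommGroup Z] [Module (R x) Z]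
    {f g : (colim X J).obj x →ₗ[R x] Z}
    (h : ∀ i m, f ((colimι X J i).app x m) = g ((colimι X J i).app x m)) : f = g := by
  classical
  refine Submodule.linearMap_qext _ (DirectSum.linearMap_ext _ fun i => LinearMap.ext fun m => ?_)
  exact h i m

theorem colim_induction {x : QuotPair G} {p : (colim X J).obj x → Prop} (zero : p 0)
    (ι : ∀ i m, p ((colimι X J i).app x m)) (add : ∀ a b, p a → p b → p (a + b))
    (m : (colim X J).obj x) : p m := by
  classical
  obtain ⟨w, rfl⟩ := Submodule.mkQ_surjective _ m
  refine DirectSum.induction_on (motive := fun w => p ((colimRel X J x).mkQ w)) w ?_ ?_ ?_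
  · rw [map_zero]; exact zero
  · exact fun i m => ι i m
  · intro a b ha hb
    rw [map_add]; exact add _ _ ha hb

/-- Homogeneous elements of the colimit are sums of images of homogeneous elements of the same
degree; maps out of the colimit are checked to preserve degrees this way. -/
theorem colim_deg_le {x : QuotPair G} {n : ℤ} {S : AddSubgroup ((colim X J).obj x)}
    (h : ∀ i, ∀ m ∈ (X i).deg x n, (colimι X J i).app x m ∈ S) : (colim X J).deg x n ≤ S := by
  classical
  rintro _ ⟨g, hg, rfl⟩
  change (colimRel X J x).mkQ g ∈ _
  rw [← DirectSum.sum_support_of g, map_sum]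
  exact sum_mem fun i _ => h i _ (hg i)

theorem exists_colim_lift {x : QuotPair G} {Z : Type u} [AddCommGroup Z] [Module (R x) Z]
    (φ : ∀ i, (X i).obj x →ₗ[R x] Z)
    (hφ : ∀ i j, ∀ u ∈ J i j, ∀ m, φ j (u.app x m) = φ i m) :
    ∃ f : (colim X J).obj x →ₗ[R x] Z, ∀ i m, f ((colimι X J i).app x m) = φ i m := by
  classical
  refine ⟨(colimRel X J x).liftQ (toModule (R x) I Z φ) (Submodule.span_le.2 ?_), fun i m => ?_⟩
  · rintro _ ⟨i, j, u, hu, m, rfl⟩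
    change toModule (R x) I Z φ _ = 0
    rw [map_sub, sub_eq_zero]
    exact (toModule_lof (R x) j _).trans ((hφ i j u hu m).trans (toModule_lof (R x) i _).symm)
  · exact toModule_lof (R x) i (M := fun i => (X i).obj x) m

theorem exists_colim_desc {N : RMod G} (φ : ∀ i, (X i).Hom N)
    (hφ : ∀ i j, ∀ u ∈ J i j, ∀ x m, (φ j).app x (u.app x m) = (φ i).app x m) :
    ∃ f : (colim X J).Hom N, ∀ i x m, f.app x ((colimι X J i).app x m) = (φ i).app x m := by
  choose f hf using fun x => exists_colim_lift X J (fun i => (φ i).app x)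
    fun i j u hu m => hφ i j u hu x m
  refine ⟨⟨f, fun x n m hm => ?_, fun {x y} h m => ?_⟩, fun i x m => hf x i m⟩
  · refine colim_deg_le X J (S := (N.deg x n).comap (f x).toAddMonoidHom) (fun i m hm => ?_) hm
    change f x _ ∈ N.deg x n
    rw [hf]
    exact (φ i).app_mem x n m hm
  · induction m using colim_induction with
    | zero => rw [map_zero, map_zero, map_zero, map_zero]
    | ι i m => rw [← (colimι X J i).naturality, hf, hf, (φ i).naturality]
    | add a b ha hb => rw [map_add, map_add, map_add, map_add, ha, hb]

/-- Extension of scalars is a left adjoint, so it commutes with colimits. In terms of universal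
properties: each `X i` supplies an extension `k i`, and uniqueness makes the `k i` compatible with
`J`. -/
theorem isExtensionOfScalars_colim {x y : QuotPair G} (h : x ≤ y)
    (hX : ∀ i, IsExtensionOfScalars (ringMap h) ((X i).map h)) :
    IsExtensionOfScalars (ringMap h) ((colim X J).map h) := by
  rw [isExtensionOfScalars_iff_existsUnique]
  intro Z _ _ g
  choose k hk huniq using fun i => (isExtensionOfScalars_iff_existsUnique _).1 (hX i) Z
    (g.comp ((colimι X J i).app x))
  obtain ⟨f, hf⟩ := exists_colim_lift X J k fun i j u hu m => by
    have : (k j).comp (u.app y) = k i := huniq i _ fun m => by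
      rw [LinearMap.comp_apply, u.naturality, hk]
      exact congrArg g (colimι_app_app X J hu x m)
    exact LinearMap.congr_fun this m
  refine ⟨f, fun m => ?_, fun f' hf' => colim_linearMap_ext X J fun i m => ?_⟩
  · induction m using colim_induction with
    | zero => rw [map_zero, map_zero, map_zero]
    | ι i m =>
      rw [← (colimι X J i).naturality, hf, hk]
      rfl
    | add a b ha hb => rw [map_add, map_add, map_add, ha, hb]
  · rw [hf]
    refine LinearMap.congr_fun (huniq i (f'.comp ((colimι X J i).app y)) fun m => ?_) m
    rw [LinearMap.comp_apply, (colimι X J i).naturality, hf']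
    rfl

theorem isQuasiCoherent_inf_isExtended_colim
    (hX : ∀ i, (IsQuasiCoherent G ⊓ IsExtended G) (X i)) :
    (IsQuasiCoherent G ⊓ IsExtended G) (colim X J) :=
  (isQuasiCoherent_inf_isExtended_iff _).2 fun x y h ha => isExtensionOfScalars_colim X J h
    fun i => (isQuasiCoherent_inf_isExtended_iff _).1 (hX i) x y h ha

end Colimit

/-- The composite of two maps of `R`-modules. -/
def Hom.comp {M N P : RMod G} (g : N.Hom P) (f : M.Hom N) : M.Hom P where
  app x := (g.app x).comp (f.app x)
  app_mem x n m h := g.app_mem x n _ (f.app_mem x n m h)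
  naturality h m := by simp [f.naturality, g.naturality]

theorem Hom.comp_apply {M N P : RMod G} (g : N.Hom P) (f : M.Hom N) (x : QuotPair G)
    (m : M.obj x) : (g.comp f).app x m = g.app x (f.app x m) := rfl

/-! ### The colimit of all small coherent modules over `N` -/

section Small

variable (N : RMod G)

/-- A small quasi-coherent extended `R`-module over `N`. -/
structure SmallOver where
  /-- the small module -/
  obj : RMod G
  isSmall : obj.IsSmall
  coh : (IsQuasiCoherent G ⊓ IsExtended G) obj
  /-- the map to `N` -/
  hom : obj.Hom N

variable {N}

open Cardinal in
/-- An enumeration of the elements of a small module. -/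
def IsSmall.emb {M : RMod G} (hM : M.IsSmall) (x : QuotPair G) : M.obj x ↪ (sizeBound G).out :=
  (⟨Sigma.mk x, sigma_mk_injective⟩ : M.obj x ↪ Σ x, M.obj x).trans
    (Classical.choice (Cardinal.le_def _ _ |>.1 (hM.trans (mk_out _).ge)))

variable (N) in
/-- The isomorphism type of a small module over `N`, recorded by the graphs of all the operations
on a fixed set of elements. -/
structure Code where
  /-- the graph of addition -/
  add : ∀ _ : QuotPair G,
    Set ((sizeBound G).out × (sizeBound G).out × (sizeBound G).out)
  /-- the graph of scalar multiplication -/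
  smul : ∀ x : QuotPair G, Set (R x × (sizeBound G).out × (sizeBound G).out)
  /-- the homogeneous elements -/
  deg : ∀ _ : QuotPair G, ℤ → Set (sizeBound G).out
  /-- the graphs of the structure maps -/
  map : ∀ x y : QuotPair G, x ≤ y → Set ((sizeBound G).out × (sizeBound G).out)
  /-- the graph of the map to `N` -/
  hom : ∀ x : QuotPair G, Set ((sizeBound G).out × N.obj x)

/-- The code of a small module over `N`. -/
def SmallOver.code (X : N.SmallOver) : N.Code where
  add x := {t | ∃ m m', t = (X.isSmall.emb x m, X.isSmall.emb x m', X.isSmall.emb x (m + m'))}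
  smul x := {t | ∃ a m, t = (a, X.isSmall.emb x m, X.isSmall.emb x (a • m))}
  deg x n := X.isSmall.emb x '' (X.obj.deg x n : Set (X.obj.obj x))
  map x y h := {t | ∃ m, t = (X.isSmall.emb x m, X.isSmall.emb y (X.obj.map h m))}
  hom x := {t | ∃ m, t = (X.isSmall.emb x m, X.hom.app x m)}

/-- Elements with the same label are matched. Labels are injective and the code records every
operation, so the matching respects all the structure. -/
theorem SmallOver.exists_hom_emb {X Y : N.SmallOver} (h : X.code = Y.code) :
    ∃ u : X.obj.Hom Y.obj, (∀ x m, Y.hom.app x (u.app x m) = X.hom.app x m) ∧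
      ∀ x m, Y.isSmall.emb x (u.app x m) = X.isSmall.emb x m := by
  have h1 : ∀ x (m : X.obj.obj x), ∃ m', Y.isSmall.emb x m' = X.isSmall.emb x m ∧
      Y.hom.app x m' = X.hom.app x m := by
    intro x m
    -- The graph of the map to `N` lists every label in use, so it yields the partner of `m`
    -- together with equality of values in `N`.
    have : (X.isSmall.emb x m, X.hom.app x m) ∈ Y.code.hom x := h ▸ ⟨m, rfl⟩
    obtain ⟨m', e⟩ := this
    exact ⟨m', (congrArg Prod.fst e).symm, (congrArg Prod.snd e).symm⟩
  choose v hv hv' using h1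
  have hinj : ∀ {x} {a b : Y.obj.obj x}, Y.isSmall.emb x a = Y.isSmall.emb x b → a = b :=
    fun h => (Y.isSmall.emb _).injective h
  let u : X.obj.Hom Y.obj :=
    { app := fun x =>
        { toFun := v x
          map_add' := fun m m' => by
            have : (X.isSmall.emb x m, X.isSmall.emb x m', X.isSmall.emb x (m + m')) ∈
              Y.code.add x := h ▸ ⟨m, m', rfl⟩
            obtain ⟨k, k', e⟩ := this
            simp only [← hv, Prod.mk.injEq] at e
            rw [hinj e.2.2, hinj e.1, hinj e.2.1]
          map_smul' := fun a m => by
            have : (a, X.isSmall.emb x m, X.isSmall.emb x (a • m)) ∈ Y.code.smul x :=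
              h ▸ ⟨a, m, rfl⟩
            obtain ⟨a', k, e⟩ := this
            simp only [← hv, Prod.mk.injEq] at e
            rw [hinj e.2.2, RingHom.id_apply, hinj e.2.1, e.1] }
      app_mem := fun x n m hm => by
        have : X.isSmall.emb x m ∈ Y.code.deg x n := h ▸ ⟨m, hm, rfl⟩
        obtain ⟨k, hk, e⟩ := this
        rw [← hv] at e
        change v x m ∈ _
        rwa [← hinj e]
      naturality := fun {x y} h' m => by
        have : (X.isSmall.emb x m, X.isSmall.emb y (X.obj.map h' m)) ∈ Y.code.map x y h' :=
          h ▸ ⟨m, rfl⟩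
        obtain ⟨k, e⟩ := this
        simp only [← hv, Prod.mk.injEq] at e
        change v y _ = Y.obj.map h' (v x m)
        rw [hinj e.2, hinj e.1] }
  exact ⟨u, hv', hv⟩

variable (N) in
/-- The codes of all small modules over `N`. -/
def CodeIndex : Type u := Set.range (SmallOver.code (N := N))

/-- A module with a given code. -/
def CodeIndex.rep (i : N.CodeIndex) : N.SmallOver := Classical.choose i.2

theorem CodeIndex.code_rep (i : N.CodeIndex) : i.rep.code = i.1 := Classical.choose_spec i.2

/-- The index of a small module over `N`. -/
def SmallOver.index (X : N.SmallOver) : N.CodeIndex := ⟨X.code, X, rfl⟩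

theorem SmallOver.exists_toRep (X : N.SmallOver) :
    ∃ (u : X.obj.Hom X.index.rep.obj) (v : X.index.rep.obj.Hom X.obj),
      (∀ x m, X.index.rep.hom.app x (u.app x m) = X.hom.app x m) ∧
      (∀ x m, X.hom.app x (v.app x m) = X.index.rep.hom.app x m) ∧
      ∀ x m, v.app x (u.app x m) = m := by
  have h : X.index.rep.code = X.code := X.index.code_rep
  obtain ⟨u, hu, hu'⟩ := exists_hom_emb h.symm
  obtain ⟨v, hv, hv'⟩ := exists_hom_emb h
  exact ⟨u, v, hu, hv, fun x m => (X.isSmall.emb x).injective (by rw [hv', hu'])⟩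

variable (N) in
/-- The maps over `N` between the representatives of the codes. -/
def overMaps (i j : N.CodeIndex) : Set (i.rep.obj.Hom j.rep.obj) :=
  {u | ∀ x m, j.rep.hom.app x (u.app x m) = i.rep.hom.app x m}

variable (N) in
/-- The colimit of all small quasi-coherent extended modules over `N`. -/
def torsion : RMod G := colim (fun i : N.CodeIndex => i.rep.obj) N.overMaps

variable (N) in
/-- The maps from the representatives of the codes. -/
def torsionι (i : N.CodeIndex) : i.rep.obj.Hom N.torsion :=
  colimι (fun i : N.CodeIndex => i.rep.obj) N.overMaps i

theorem torsionι_app_app {i j : N.CodeIndex} (u : i.rep.obj.Hom j.rep.obj)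
    (hu : ∀ x m, j.rep.hom.app x (u.app x m) = i.rep.hom.app x m) (x : QuotPair G)
    (m : i.rep.obj.obj x) :
    (N.torsionι j).app x (u.app x m) = (N.torsionι i).app x m :=
  colimι_app_app (fun i : N.CodeIndex => i.rep.obj) N.overMaps hu x m

theorem torsion_linearMap_ext {x : QuotPair G} {Z : Type*} [AddCommGroup Z] [Module (R x) Z]
    {f g : N.torsion.obj x →ₗ[R x] Z}
    (h : ∀ i m, f ((N.torsionι i).app x m) = g ((N.torsionι i).app x m)) : f = g :=
  colim_linearMap_ext (fun i : N.CodeIndex => i.rep.obj) N.overMaps h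

variable (N) in
theorem isQuasiCoherent_inf_isExtended_torsion :
    (IsQuasiCoherent G ⊓ IsExtended G) N.torsion :=
  isQuasiCoherent_inf_isExtended_colim _ _ fun i => i.rep.coh

variable (N) in
theorem exists_torsionCounit : ∃ q : N.torsion.Hom N,
    ∀ i x m, q.app x ((N.torsionι i).app x m) = i.rep.hom.app x m :=
  exists_colim_desc (fun i : N.CodeIndex => i.rep.obj) N.overMaps (fun i => i.rep.hom)
    fun _ _ _ hu x m => hu x m

variable (N) in
/-- The map from the colimit of the small modules over `N` to `N`. -/
def torsionCounit : N.torsion.Hom N := Classical.choose N.exists_torsionCounit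

theorem torsionCounit_ι (i : N.CodeIndex) (x : QuotPair G) (m : i.rep.obj.obj x) :
    N.torsionCounit.app x ((N.torsionι i).app x m) = i.rep.hom.app x m :=
  Classical.choose_spec N.exists_torsionCounit i x m

/-- The canonical map from a small module over `N`. -/
def SmallOver.toTorsion (X : N.SmallOver) : X.obj.Hom N.torsion :=
  (N.torsionι X.index).comp (Classical.choose X.exists_toRep)

/-- Conjugating `f` with the comparison maps to the representatives gives a map over `N` between
representatives, which the colimit identifies. In particular the choices of comparison maps are
immaterial. -/
theorem SmallOver.toTorsion_naturality {X Y : N.SmallOver} (f : X.obj.Hom Y.obj)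
    (hf : ∀ x m, Y.hom.app x (f.app x m) = X.hom.app x m) (x : QuotPair G) (m : X.obj.obj x) :
    Y.toTorsion.app x (f.app x m) = X.toTorsion.app x m := by
  obtain ⟨v, hu, hv, hvu⟩ := Classical.choose_spec X.exists_toRep
  obtain ⟨-, hu', -, -⟩ := Classical.choose_spec Y.exists_toRep
  have := torsionι_app_app (((Classical.choose Y.exists_toRep).comp f).comp v)
    (fun x m => by rw [Hom.comp_apply, Hom.comp_apply, hu', hf, hv]) x
    ((Classical.choose X.exists_toRep).app x m)
  rw [Hom.comp_apply, Hom.comp_apply, hvu] at this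
  exact this

theorem SmallOver.torsionCounit_toTorsion (X : N.SmallOver) (x : QuotPair G) (m : X.obj.obj x) :
    N.torsionCounit.app x (X.toTorsion.app x m) = X.hom.app x m := by
  obtain ⟨-, hu, -, -⟩ := Classical.choose_spec X.exists_toRep
  exact (torsionCounit_ι _ x _).trans (hu x m)

/-- The chosen comparison map of a representative need not be the identity, but it is a map over `N`
and so is absorbed in the colimit. -/
theorem toTorsion_rep (i : N.CodeIndex) (x : QuotPair G) (m : i.rep.obj.obj x) :
    i.rep.toTorsion.app x m = (N.torsionι i).app x m := by
  obtain ⟨-, hu, -, -⟩ := Classical.choose_spec i.rep.exists_toRep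
  exact torsionι_app_app _ hu x m

end Small

/-! ### The universal property of the torsion module -/

section Universal

variable {N X Y : RMod G}

open Cardinal in
theorem exists_small_sub_ge (hX : (IsQuasiCoherent G ⊓ IsExtended G) X) {P P' : X.Sub}
    (hP : P.toRMod.IsSmall) (hP' : P'.toRMod.IsSmall) :
    ∃ P'' : X.Sub, P''.toRMod.IsSmall ∧ (IsQuasiCoherent G ⊓ IsExtended G) P''.toRMod ∧
      (∀ x, P.carrier x ≤ P''.carrier x) ∧ ∀ x, P'.carrier x ≤ P''.carrier x := by
  have hcard : ∀ {P : X.Sub}, P.toRMod.IsSmall →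
      #(Set.range fun e : Σ x, P.carrier x => (⟨e.1, e.2⟩ : Σ x, X.obj x)) ≤ sizeBound G :=
    fun h => mk_range_le.trans h
  obtain ⟨P'', h1, h2, h3⟩ := X.exists_small_sub hX
    (Set.range (fun e : Σ x, P.carrier x => (⟨e.1, e.2⟩ : Σ x, X.obj x)) ∪
      Set.range fun e : Σ x, P'.carrier x => (⟨e.1, e.2⟩ : Σ x, X.obj x))
    ((mk_union_le _ _).trans (add_le_of_le aleph0_le_sizeBound (hcard hP) (hcard hP')))
  exact ⟨P'', h2, h3, fun x m hm => h1 ⟨x, m⟩ (Or.inl ⟨⟨x, m, hm⟩, rfl⟩),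
    fun x m hm => h1 ⟨x, m⟩ (Or.inr ⟨⟨x, m, hm⟩, rfl⟩)⟩

open Cardinal in
theorem exists_small_sub_mem (hX : (IsQuasiCoherent G ⊓ IsExtended G) X) (x : QuotPair G)
    (m : X.obj x) :
    ∃ P : X.Sub, m ∈ P.carrier x ∧ P.toRMod.IsSmall ∧
      (IsQuasiCoherent G ⊓ IsExtended G) P.toRMod := by
  obtain ⟨P, h1, h2, h3⟩ := X.exists_small_sub hX {⟨x, m⟩}
    (((Set.countable_singleton _).le_aleph0).trans aleph0_le_sizeBound)
  exact ⟨P, h1 ⟨x, m⟩ rfl, h2, h3⟩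

/-- A small subdiagram of a module over `N`, as a module over `N`. -/
def Sub.toSmallOver (P : X.Sub) (hP : P.toRMod.IsSmall)
    (hP' : (IsQuasiCoherent G ⊓ IsExtended G) P.toRMod) (φ : X.Hom N) : N.SmallOver :=
  ⟨P.toRMod, hP, hP', φ.comp P.ι⟩

/-- The underlying function of the canonical map to the torsion of `N`. -/
def liftFun (hX : (IsQuasiCoherent G ⊓ IsExtended G) X) (φ : X.Hom N) (x : QuotPair G)
    (m : X.obj x) : N.torsion.obj x :=
  have h := Classical.choose_spec (exists_small_sub_mem hX x m)
  ((Classical.choose (exists_small_sub_mem hX x m)).toSmallOver h.2.1 h.2.2 φ).toTorsion.app x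
    ⟨m, h.1⟩

/-- Independence of the chosen subdiagram: two small subdiagrams lie in a common small coherent one,
and the canonical maps are natural for the inclusions. -/
theorem liftFun_eq (hX : (IsQuasiCoherent G ⊓ IsExtended G) X) (φ : X.Hom N) (P : X.Sub)
    (hP : P.toRMod.IsSmall) (hP' : (IsQuasiCoherent G ⊓ IsExtended G) P.toRMod)
    (x : QuotPair G) (m : P.carrier x) :
    liftFun hX φ x m = (P.toSmallOver hP hP' φ).toTorsion.app x m := by
  have h := Classical.choose_spec (exists_small_sub_mem hX x (m : X.obj x))
  obtain ⟨P'', h1, h2, h3, h4⟩ := exists_small_sub_ge hX h.2.1 hP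
  have e1 := SmallOver.toTorsion_naturality
    (X := (Classical.choose (exists_small_sub_mem hX x (m : X.obj x))).toSmallOver h.2.1 h.2.2 φ)
    (Y := P''.toSmallOver h1 h2 φ) (Sub.inclusion h3) (fun _ _ => rfl) x ⟨m, h.1⟩
  have e2 := SmallOver.toTorsion_naturality (X := P.toSmallOver hP hP' φ)
    (Y := P''.toSmallOver h1 h2 φ) (Sub.inclusion h4) (fun _ _ => rfl) x m
  exact e1.symm.trans e2

/-- The canonical map to the torsion of `N` from a quasi-coherent extended module over `N`. -/
def torsionLift (hX : (IsQuasiCoherent G ⊓ IsExtended G) X) (φ : X.Hom N) : X.Hom N.torsion where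
  app x :=
    { toFun := liftFun hX φ x
      map_add' := fun m m' => by
        obtain ⟨P₁, h₁, hs₁, -⟩ := exists_small_sub_mem hX x m
        obtain ⟨P₂, h₂, hs₂, -⟩ := exists_small_sub_mem hX x m'
        -- On one small `P` containing both elements the lift is a module map.
        obtain ⟨P, hP, hP', h3, h4⟩ := exists_small_sub_ge hX hs₁ hs₂
        let a : P.carrier x := ⟨m, h3 x h₁⟩
        let b : P.carrier x := ⟨m', h4 x h₂⟩
        exact (liftFun_eq hX φ P hP hP' x (a + b)).trans
          ((((P.toSmallOver hP hP' φ).toTorsion.app x).map_add a b).trans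
            (congrArg₂ (· + ·) (liftFun_eq hX φ P hP hP' x a).symm
              (liftFun_eq hX φ P hP hP' x b).symm))
      map_smul' := fun a m => by
        obtain ⟨P, h, hP, hP'⟩ := exists_small_sub_mem hX x m
        let k : P.carrier x := ⟨m, h⟩
        exact (liftFun_eq hX φ P hP hP' x (a • k)).trans
          ((((P.toSmallOver hP hP' φ).toTorsion.app x).map_smul a k).trans
            (congrArg (a • ·) (liftFun_eq hX φ P hP hP' x k).symm)) }
  app_mem x n m hm := by
    obtain ⟨P, h, hP, hP'⟩ := exists_small_sub_mem hX x m
    change liftFun hX φ x m ∈ _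
    rw [liftFun_eq hX φ P hP hP' x ⟨m, h⟩]
    exact (P.toSmallOver hP hP' φ).toTorsion.app_mem x n ⟨m, h⟩ hm
  naturality {x y} h' m := by
    obtain ⟨P, h, hP, hP'⟩ := exists_small_sub_mem hX x m
    exact (liftFun_eq hX φ P hP hP' y ⟨X.map h' m, P.map_mem h' m h⟩).trans
      (((P.toSmallOver hP hP' φ).toTorsion.naturality h' ⟨m, h⟩).trans
        (congrArg (N.torsion.map h') (liftFun_eq hX φ P hP hP' x ⟨m, h⟩).symm))

theorem lift_apply (hX : (IsQuasiCoherent G ⊓ IsExtended G) X) (φ : X.Hom N) (P : X.Sub)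
    (hP : P.toRMod.IsSmall) (hP' : (IsQuasiCoherent G ⊓ IsExtended G) P.toRMod)
    (x : QuotPair G) (m : P.carrier x) :
    (torsionLift hX φ).app x m = (P.toSmallOver hP hP' φ).toTorsion.app x m :=
  liftFun_eq hX φ P hP hP' x m

theorem torsionCounit_lift (hX : (IsQuasiCoherent G ⊓ IsExtended G) X) (φ : X.Hom N)
    (x : QuotPair G) (m : X.obj x) :
    N.torsionCounit.app x ((torsionLift hX φ).app x m) = φ.app x m := by
  obtain ⟨P, h, hP, hP'⟩ := exists_small_sub_mem hX x m
  exact (congrArg _ (lift_apply hX φ P hP hP' x ⟨m, h⟩)).trans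
    ((P.toSmallOver hP hP' φ).torsionCounit_toTorsion x ⟨m, h⟩)

-- The image under `f` of a small subdiagram is a small set, hence lies in a small coherent
-- subdiagram of `Y`; this reduces naturality to small modules.
open Cardinal in
theorem lift_naturality (hX : (IsQuasiCoherent G ⊓ IsExtended G) X)
    (hY : (IsQuasiCoherent G ⊓ IsExtended G) Y) (φ : X.Hom N) (ψ : Y.Hom N) (f : X.Hom Y)
    (hf : ∀ x m, ψ.app x (f.app x m) = φ.app x m) (x : QuotPair G) (m : X.obj x) :
    (torsionLift hY ψ).app x (f.app x m) = (torsionLift hX φ).app x m := by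
  obtain ⟨P, h, hP, hP'⟩ := exists_small_sub_mem hX x m
  obtain ⟨P', h1, h2, h3⟩ := Y.exists_small_sub hY
    (Set.range fun e : Σ x, P.carrier x => (⟨e.1, f.app e.1 e.2⟩ : Σ x, Y.obj x))
    (mk_range_le.trans hP)
  have hmem : ∀ x (k : P.carrier x), f.app x k ∈ P'.carrier x := fun x k => h1 _ ⟨⟨x, k⟩, rfl⟩
  have e := SmallOver.toTorsion_naturality (X := P.toSmallOver hP hP' φ)
    (Y := P'.toSmallOver h2 h3 ψ) (P'.codRestrict (f.comp P.ι) hmem) (fun x k => hf x (P.ι.app x k)) x ⟨m, h⟩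
  exact (lift_apply hY ψ P' h2 h3 x ⟨f.app x m, hmem x ⟨m, h⟩⟩).trans
    (e.trans (lift_apply hX φ P hP hP' x ⟨m, h⟩).symm)

theorem lift_rep (i : N.CodeIndex) (x : QuotPair G) (m : i.rep.obj.obj x) :
    (torsionLift i.rep.coh i.rep.hom).app x m = (N.torsionι i).app x m := by
  obtain ⟨P, h, hP, hP'⟩ := exists_small_sub_mem i.rep.coh x m
  rw [← toTorsion_rep]
  exact (lift_apply _ _ P hP hP' x ⟨m, h⟩).trans
    (SmallOver.toTorsion_naturality (X := P.toSmallOver hP hP' i.rep.hom) (Y := i.rep) P.ι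
      (fun _ _ => rfl) x ⟨m, h⟩).symm

/-- It suffices to look at images of representatives. Each `torsionι i` is a map over `N`, so
naturality reduces the claim to `lift_rep`. -/
theorem lift_torsionCounit (x : QuotPair G) (m : N.torsion.obj x) :
    (torsionLift N.isQuasiCoherent_inf_isExtended_torsion N.torsionCounit).app x m = m := by
  refine LinearMap.congr_fun (g := LinearMap.id) (torsion_linearMap_ext fun i m => ?_) m
  rw [LinearMap.id_apply, lift_naturality i.rep.coh _ i.rep.hom _ (N.torsionι i)
    (fun x m => torsionCounit_ι i x m), lift_rep]

/-- As `g` is a map over `N`, the lift of `φ` is `g` followed by the lift of the counit, which is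
the identity. -/
theorem eq_lift (hX : (IsQuasiCoherent G ⊓ IsExtended G) X) (φ : X.Hom N) (g : X.Hom N.torsion)
    (hg : ∀ x m, N.torsionCounit.app x (g.app x m) = φ.app x m) : g = torsionLift hX φ := by
  refine Hom.ext (funext fun x => LinearMap.ext fun m => ?_)
  rw [← lift_naturality hX N.isQuasiCoherent_inf_isExtended_torsion φ N.torsionCounit g hg x m,
    lift_torsionCounit]

end Universal

end RMod

/-! ### The adjunction -/

variable (G) in
/-- The value of the torsion functor at `Y`. -/
def torsionObj (Y : AHat G) : ACat G :=
  ⟨Y.obj.torsion, Y.obj.isQuasiCoherent_inf_isExtended_torsion⟩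

/-- The universal property of `torsionObj`. -/
def torsionHomEquiv (X : ACat G) (Y : AHat G) :
    ((incl G).obj X ⟶ Y) ≃ (X ⟶ torsionObj G Y) where
  toFun φ := ⟨RMod.torsionLift X.property φ.hom⟩
  invFun g := ⟨RMod.Hom.comp Y.obj.torsionCounit g.hom⟩
  left_inv φ := by
    refine InducedCategory.Hom.ext (RMod.Hom.ext (funext fun x => LinearMap.ext fun m => ?_))
    exact RMod.torsionCounit_lift X.property φ.hom x m
  right_inv g := by
    refine InducedCategory.Hom.ext ?_
    exact (RMod.eq_lift X.property _ g.hom fun _ _ => rfl).symm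

variable (G) in
theorem incl_isLeftAdjoint : (incl G).IsLeftAdjoint :=
  ⟨_, ⟨Adjunction.adjunctionOfEquivRight torsionHomEquiv (by
    intro X' X Y f g
    refine InducedCategory.Hom.ext ?_
    refine (RMod.eq_lift X'.property _ _ fun x m => ?_).symm
    exact RMod.torsionCounit_lift X.property g.hom x (f.hom.app x m))⟩⟩

section Adjunction

variable {C D : Type*} [Category C] [Category D] {F : C ⥤ D} {U U' : D ⥤ C}

/-- Compatibility with the counits prescribes the adjoint transpose of each component of `θ`, so
nothing is left to choose. -/
theorem existsUnique_iso_rightAdjoint (adj : F ⊣ U) (adj' : F ⊣ U') :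
    ∃! θ : U ≅ U', Functor.whiskerRight θ.hom F ≫ adj'.counit = adj.counit := by
  refine ⟨adj.rightAdjointUniq adj', adj.rightAdjointUniq_hom_counit adj', fun θ hθ => ?_⟩
  refine Iso.ext (NatTrans.ext (funext fun Y => (adj'.homEquiv _ _).symm.injective ?_))
  rw [Adjunction.homEquiv_symm_rightAdjointUniq_hom_app, Adjunction.homEquiv_counit]
  exact congrArg (fun η => η.app Y) hθ

end Adjunction

end TorusModel

end

theorem theorem7p1 (r : ℕ) (G : Type u) [CommGroup G] [TopologicalSpace G]
    (hG : Nonempty (G ≃ₜ* (Fin r → Circle))) :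
    ∃ (Γ : TorusModel.AHat G ⥤ TorusModel.ACat G) (adj : TorusModel.incl G ⊣ Γ),
      (∀ X : TorusModel.ACat G, IsIso (adj.unit.app X)) ∧
      (∀ Y : TorusModel.AHat G, TorusModel.IsQuasiCoherent G Y.obj →
        IsIso (adj.counit.app Y)) ∧
      (∀ Y : TorusModel.AHat G, TorusModel.IsQuasiCoherent G (Γ.obj Y).obj) ∧
      (∀ (Γ' : TorusModel.AHat G ⥤ TorusModel.ACat G) (adj' : TorusModel.incl G ⊣ Γ'),
        ∃! θ : Γ ≅ Γ', Functor.whiskerRight θ.hom (TorusModel.incl G) ≫ adj'.counit =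
          adj.counit) := by
  obtain ⟨Γ, ⟨adj⟩⟩ := TorusModel.incl_isLeftAdjoint G
  -- The unit is invertible because its left adjoint `incl` is fully faithful.
  refine ⟨Γ, adj, fun X => inferInstance, fun Y hY => ?_, fun Y => (Γ.obj Y).property.1,
    fun Γ' adj' => TorusModel.existsUnique_iso_rightAdjoint adj adj'⟩
  -- A quasi-coherent `Y` is itself in the image of `incl`, where full faithfulness makes the counit
  -- invertible.
  exact inferInstanceAs (IsIso (adj.counit.app
    ((TorusModel.incl G).obj ⟨Y.obj, hY, Y.property⟩)))
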